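/- Let $m,n,k\ge 0$ be integers and let $\Lambda=(\Lambda_1,\dots,\Lambda_{m+n})\in\mathbb C^{m+n}$, $z=(z_1,\dots,z_k)\in\mathbb C^k$. Call the index $i\in\{1,\dots,m+n\}$ even if $i\le m$ and odd if $i>m$. Let $\mathcal D$ be the complex superalgebra generated by $x_{i,a},\partial_{i,a}$ ($1\le i\le m+n$, $1\le a\le k$), where $x_{i,a}$ and $\partial_{i,a}$ have the parity of $i$, with the relations given by the supercommutators $$[x_{i,a},x_{j,b}]=[\partial_{i,a},\partial_{j,b}]=0,\qquad [\partial_{i,a},x_{j,b}]=\delta_{ij}\delta_{ab}.$$ Let $\mathcal D_u=\mathcal D((u^{-1}))$ be the algebra of Laurent series in $u^{-1}$ with coefficients in $\mathcal D$ ($u$ even and central), and let $\mathcal D_u[\partial_u]$ be the algebra of differential operators $\sum_{r=0}^{M} f_r\partial_u^r$, $f_r\in\mathcal D_u$, with $\partial_u f=f\partial_u+\frac{df}{du}$ for $f\in\mathcal D_u$. Here $(u-\Lambda_i)^{-1}=\sum_{r\ge1}\Lambda_i^{r-1}u^{-r}$. Consider the $k\times k$ matrix over $\mathcal D_u[\partial_u]$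 $$G(\Lambda,z)=\Big(\delta_{ab}(\partial_u-z_a)-\sum_{i=1}^{m+n}\frac{x_{i,a}\,\partial_{i,b}}{u-\Lambda_i}\Big)_{a,b=1,\dots,k}$$ and its column determinant $\operatorname{cdet}G=\sum_{\sigma\in\mathfrak S_k}\operatorname{sgn}(\sigma)\,G_{\sigma(1),1}G_{\sigma(2),2}\cdots G_{\sigma(k),k}$. For a subset $\mathfrak a=\{a_1<\dots<a_l\}\subset\{1,\dots,k\}$ let $J(\mathfrak a)$ be the set of functions $j:\{1,\dots,k\}\to\{0,1,\dots,m+n\}$ such that $j(a)=0$ if and only if $a\notin\mathfrak a$, and $|j^{-1}(i)|\le1$ for all $i\in\{1,\dots,m\}$. For $j_1,j_2\in J(\mathfrak a)$ write $j_1\sim j_2$ if $|j_1^{-1}(i)|=|j_2^{-1}(i)|$ for all $i$. In that case let $\sigma_{j_1,j_2}$ be the unique permutation of $\mathfrak a$ that maps $j_2^{-1}(i)$ to $j_1^{-1}(i)$ by an increasing function for each $i=1,\dots,m+n$, and set $$c(j_1,j_2)=(-1)^{\#}\,\operatorname{sgn}(\sigma_{j_1,j_2})\,(-1)^{l},$$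 where $\#$ is the number of pairs $a<a'$ in $\mathfrak a$ with $\sigma_{j_1,j_2}(a)<\sigma_{j_1,j_2}(a')$, $j_2(a)>m$ and $j_2(a')>m$. For $j\in J(\mathfrak a)$ put $\boldsymbol x_j=x_{j(a_1),a_1}\cdots x_{j(a_l),a_l}$ and $\boldsymbol\partial_j=\partial_{j(a_1),a_1}\cdots\partial_{j(a_l),a_l}$. Then the normal ordered expansion of the column determinant of $G(\Lambda,z)$ (all $x$ to the left of all $\partial_{i,a}$, these to the left of all functions of $u$, these to the left of $\partial_u$) is $$\operatorname{cdet}G(\Lambda,z)=\sum_{\mathfrak a\subset\{1,\dots,k\}}\ \sum_{\substack{j_1,j_2\in J(\mathfrak a)\\ j_1\sim j_2}}c(j_1,j_2)\prod_{i=m+1}^{m+n}|j_2^{-1}(i)|!\ \ \boldsymbol x_{j_1}\boldsymbol\partial_{j_2}\prod_{a\in\mathfrak a}(u-\Lambda_{j_2(a)})^{-1}\prod_{a\notin\mathfrak a}(\partial_u-z_a)$$ in $\mathcal D_u[\partial_u]$. -/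

import Mathlib

noncomputable section

namespace CapelliSuper

/-! ### Differential operators `A[∂]` over a ring with a derivation -/

/-- A derivation of a (not necessarily commutative) ring `A`. -/
structure RingDeriv (A : Type*) [Ring A] where
  /-- the underlying additive map -/
  toHom : A →+ A
  leibniz : ∀ a b : A, toHom (a * b) = toHom a * b + a * toHom b

/-- The ring `A[∂]` of differential operators `∑ r, a_r ∂ ^ r` (finite sums, `a_r ∈ A`, coefficients
on the left). The element `f` stands for `∑ r, f r ∂ ^ r`. -/
def DiffOp {A : Type*} [Ring A] (_δ : RingDeriv A) : Type _ := ℕ →₀ A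

namespace DiffOp

variable {A : Type*} [Ring A] {δ : RingDeriv A}

instance : AddCommGroup (DiffOp δ) := inferInstanceAs (AddCommGroup (ℕ →₀ A))

/-- The term `a ∂ ^ r`. -/
def term (δ : RingDeriv A) (r : ℕ) : A →+ DiffOp δ := Finsupp.singleAddHom r

theorem addHom_ext' {M : Type*} [AddZeroClass M] {f g : DiffOp δ →+ M}
    (h : ∀ r a, f (term δ r a) = g (term δ r a)) : f = g :=
  Finsupp.addHom_ext h

/-- Left multiplication by `∂`:  `∂ (a ∂ ^ r) = a ∂ ^ (r + 1) + a' ∂ ^ r`. -/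
def leftD (δ : RingDeriv A) : AddMonoid.End (DiffOp δ) :=
  Finsupp.liftAddHom (M := A) (N := DiffOp δ)
    (fun r => term δ (r + 1) + (term δ r).comp δ.toHom)

/-- Left multiplication by an element of `A`:  `a (b ∂ ^ r) = (a b) ∂ ^ r`. -/
def leftC (δ : RingDeriv A) : A →+* AddMonoid.End (DiffOp δ) :=
  Module.toAddMonoidEnd A (ℕ →₀ A)

/-- Left multiplication by `∑ r, a_r ∂ ^ r`. -/
def leftMul (δ : RingDeriv A) : DiffOp δ →+ AddMonoid.End (DiffOp δ) :=
  Finsupp.liftAddHom (M := A) (N := AddMonoid.End (DiffOp δ))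
    (fun r => (AddMonoidHom.mulRight (leftD δ ^ r)).comp (leftC δ).toAddMonoidHom)

theorem end_mul_apply (f g : AddMonoid.End (DiffOp δ)) (x : DiffOp δ) : (f * g) x = f (g x) := rfl

theorem leftD_term (r : ℕ) (a : A) :
    leftD δ (term δ r a) = term δ (r + 1) a + term δ r (δ.toHom a) := by
  change Finsupp.liftAddHom (M := A) (N := DiffOp δ) _ (Finsupp.single r a) = _
  rw [Finsupp.liftAddHom_apply_single]
  rfl

theorem leftC_term (a : A) (r : ℕ) (b : A) :
    leftC δ a (term δ r b) = term δ r (a * b) :=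
  Finsupp.smul_single a r b

theorem leftMul_term (r : ℕ) (a : A) :
    leftMul δ (term δ r a) = leftC δ a * leftD δ ^ r := by
  change Finsupp.liftAddHom (M := A) (N := AddMonoid.End (DiffOp δ)) _ (Finsupp.single r a) = _
  rw [Finsupp.liftAddHom_apply_single]
  rfl

theorem leftD_mul_leftC (a : A) :
    leftD δ * leftC δ a = leftC δ a * leftD δ + leftC δ (δ.toHom a) := by
  apply addHom_ext'
  intro r b
  change leftD δ (leftC δ a (term δ r b)) =
    leftC δ a (leftD δ (term δ r b)) + leftC δ (δ.toHom a) (term δ r b)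
  rw [leftC_term, leftD_term, leftD_term, leftC_term, map_add, leftC_term, leftC_term, δ.leibniz,
    map_add]
  abel

theorem leftD_pow_one (r : ℕ) : (leftD δ ^ r) (term δ 0 1) = term δ r 1 := by
  have h1 : δ.toHom 1 = 0 := by simpa using δ.leibniz 1 1
  induction r with
  | zero => rfl
  | succ r ih =>
    rw [pow_succ', end_mul_apply, ih, leftD_term, h1, map_zero, add_zero]

theorem leftMul_one (f : DiffOp δ) : leftMul δ f (term δ 0 1) = f := by
  have h : (AddMonoidHom.eval (term δ 0 (1 : A))).comp (leftMul δ)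
      = AddMonoidHom.id (DiffOp δ) := by
    apply addHom_ext'
    intro r a
    change leftMul δ (term δ r a) (term δ 0 1) = term δ r a
    rw [leftMul_term, end_mul_apply, leftD_pow_one, leftC_term, mul_one]
  exact DFunLike.congr_fun h f

theorem leftMul_leftC (a : A) (f : DiffOp δ) :
    leftMul δ (leftC δ a f) = leftC δ a * leftMul δ f := by
  have h : (leftMul δ).comp (leftC δ a)
      = (AddMonoidHom.mulLeft (leftC δ a)).comp (leftMul δ) := by
    apply addHom_ext'
    intro r b
    change leftMul δ (leftC δ a (term δ r b)) = leftC δ a * leftMul δ (term δ r b)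
    rw [leftC_term, leftMul_term, leftMul_term, map_mul, mul_assoc]
  exact DFunLike.congr_fun h f

theorem leftMul_leftD (f : DiffOp δ) :
    leftMul δ (leftD δ f) = leftD δ * leftMul δ f := by
  have h : (leftMul δ).comp (leftD δ)
      = (AddMonoidHom.mulLeft (leftD δ)).comp (leftMul δ) := by
    apply addHom_ext'
    intro r b
    change leftMul δ (leftD δ (term δ r b)) = leftD δ * leftMul δ (term δ r b)
    rw [leftD_term, map_add, leftMul_term, leftMul_term, leftMul_term, ← mul_assoc,
      leftD_mul_leftC, add_mul, pow_succ', mul_assoc]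
  exact DFunLike.congr_fun h f

theorem leftMul_pow_leftD (r : ℕ) (f : DiffOp δ) :
    leftMul δ ((leftD δ ^ r) f) = leftD δ ^ r * leftMul δ f := by
  induction r with
  | zero => rw [pow_zero, one_mul]; rfl
  | succ r ih => rw [pow_succ', end_mul_apply, leftMul_leftD, ih, mul_assoc]

theorem leftMul_leftMul (f g : DiffOp δ) :
    leftMul δ (leftMul δ f g) = leftMul δ f * leftMul δ g := by
  have h : (leftMul δ).comp ((AddMonoidHom.eval g).comp (leftMul δ))
      = (AddMonoidHom.mulRight (leftMul δ g)).comp (leftMul δ) := by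
    apply addHom_ext'
    intro r b
    change leftMul δ (leftMul δ (term δ r b) g) = leftMul δ (term δ r b) * leftMul δ g
    rw [leftMul_term, end_mul_apply, leftMul_leftC, leftMul_pow_leftD, mul_assoc]
  exact DFunLike.congr_fun h f

/-- The ring structure of `A[∂]`, with `(a ∂ ^ r) g = a (∂ (∂ ⋯ (∂ g)))`. -/
instance : Ring (DiffOp δ) :=
  { (inferInstance : AddCommGroup (DiffOp δ)) with
    mul := fun f g => leftMul δ f g
    one := term δ 0 1
    left_distrib := fun f g h => map_add (leftMul δ f) g h
    right_distrib := fun f g h => by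
      change leftMul δ (f + g) h = leftMul δ f h + leftMul δ g h
      rw [map_add]
      rfl
    zero_mul := fun f => by
      change leftMul δ 0 f = 0
      rw [map_zero]
      rfl
    mul_zero := fun f => map_zero (leftMul δ f)
    mul_assoc := fun f g h => by
      change leftMul δ (leftMul δ f g) h = leftMul δ f (leftMul δ g h)
      rw [leftMul_leftMul]
      rfl
    one_mul := fun f => by
      change leftMul δ (term δ 0 1) f = f
      rw [leftMul_term, map_one, pow_zero, one_mul]
      rfl
    mul_one := fun f => leftMul_one f
    zsmul := fun c f => c • f
    zsmul_zero' := fun f => zero_zsmul f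
    zsmul_succ' := fun c f => SubNegMonoid.zsmul_succ' c f
    zsmul_neg' := fun c f => SubNegMonoid.zsmul_neg' c f
    neg_add_cancel := neg_add_cancel }

theorem mul_def (f g : DiffOp δ) : f * g = leftMul δ f g := rfl

/-- The inclusion `A → A[∂]`. -/
def const (δ : RingDeriv A) : A →+* DiffOp δ :=
  { term δ 0 with
    map_one' := rfl
    map_mul' := fun a b => by
      change term δ 0 (a * b) = leftMul δ (term δ 0 a) (term δ 0 b)
      rw [leftMul_term, pow_zero, mul_one, leftC_term] }

/-- The operator `∂ ∈ A[∂]`. -/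
def del (δ : RingDeriv A) : DiffOp δ := term δ 1 1

theorem del_mul_const (a : A) :
    del δ * const δ a = const δ a * del δ + const δ (δ.toHom a) := by
  change leftMul δ (term δ 1 1) (term δ 0 a)
    = leftMul δ (term δ 0 a) (term δ 1 1) + term δ 0 (δ.toHom a)
  rw [leftMul_term, leftMul_term, map_one, pow_zero, mul_one, one_mul, pow_one, leftD_term,
    leftC_term, mul_one]

theorem term_eq (r : ℕ) (a : A) : term δ r a = const δ a * del δ ^ r := by
  have hd : ∀ r : ℕ, del δ ^ r = term δ r 1 := by
    intro r
    induction r with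
    | zero => rfl
    | succ r ih =>
      rw [pow_succ', ih, mul_def, del, leftMul_term, map_one, one_mul, pow_one, leftD_term,
        show δ.toHom 1 = 0 by simpa using δ.leibniz 1 1, map_zero, add_zero]
  rw [hd, mul_def]
  change _ = leftMul δ (term δ 0 a) (term δ r 1)
  rw [leftMul_term, pow_zero, mul_one, leftC_term, mul_one]

end DiffOp

/-! ### Laurent series in `u⁻¹` -/

section Laurent

variable (A : Type*) [Ring A]

/-- `A((u⁻¹))`. The coefficient at `r : ℤ` is the coefficient of `u ^ (-r)`. -/
abbrev LaurentInv : Type _ := HahnSeries ℤ A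

/-- The element `u`. -/
def uVar : LaurentInv A := HahnSeries.single (-1) 1

/-- The map `d/du`, taking `∑ r, a_r u ^ (-r)` to `∑ r, (-r) a_r u ^ (-r - 1)`. -/
def dduHom : LaurentInv A →+ LaurentInv A where
  toFun f := HahnSeries.ofSuppBddBelow (fun r : ℤ => -(r - 1) • f.coeff (r - 1)) <| by
    refine ⟨f.order + 1, fun x h => ?_⟩
    contrapose! h
    rw [Function.notMem_support,
      HahnSeries.coeff_eq_zero_of_lt_order (show x - 1 < f.order by linarith), smul_zero]
  map_zero' := by
    ext r
    simp
  map_add' f g := by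
    ext r
    simp

theorem dduHom_coeff (f : LaurentInv A) (r : ℤ) :
    (dduHom A f).coeff r = -(r - 1) • f.coeff (r - 1) := rfl

/-- The map `∑ r, a_r u ^ (-r) ↦ ∑ r, (-r) a_r u ^ (-r)`, that is, `u d/du`. -/
def eulerHom (f : LaurentInv A) : LaurentInv A :=
  HahnSeries.ofSuppBddBelow (fun r : ℤ => -r • f.coeff r) <| by
    refine ⟨f.order, fun x h => ?_⟩
    contrapose! h
    rw [Function.notMem_support, HahnSeries.coeff_eq_zero_of_lt_order h, smul_zero]

theorem eulerHom_coeff (f : LaurentInv A) (r : ℤ) : (eulerHom A f).coeff r = -r • f.coeff r := rfl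

theorem eulerHom_support (f : LaurentInv A) : (eulerHom A f).support ⊆ f.support := by
  intro r hr h
  apply hr
  change -r • f.coeff r = 0
  rw [h, smul_zero]

theorem eulerHom_mul (f g : LaurentInv A) :
    eulerHom A (f * g) = eulerHom A f * g + f * eulerHom A g := by
  ext r
  rw [HahnSeries.coeff_add, eulerHom_coeff, HahnSeries.coeff_mul,
    HahnSeries.coeff_mul_left' f.isPWO_support (eulerHom_support A f),
    HahnSeries.coeff_mul_right' g.isPWO_support (eulerHom_support A g), Finset.smul_sum,
    ← Finset.sum_add_distrib]
  refine Finset.sum_congr rfl fun p hp => ?_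
  have hp' : p.1 + p.2 = r := (Finset.mem_antidiagonal.mp hp).2.2
  rw [eulerHom_coeff, eulerHom_coeff, ← hp', smul_mul_assoc, mul_smul_comm, neg_add, add_smul]

theorem dduHom_eq_left (f : LaurentInv A) :
    dduHom A f = HahnSeries.single 1 1 * eulerHom A f := by
  ext r
  obtain ⟨s, rfl⟩ : ∃ s, r = s + 1 := ⟨r - 1, by ring⟩
  rw [HahnSeries.coeff_single_mul_add, dduHom_coeff, eulerHom_coeff, add_sub_cancel_right, one_mul]

theorem single_mul_comm (f : LaurentInv A) :
    HahnSeries.single (1 : ℤ) (1 : A) * f = f * HahnSeries.single 1 1 := by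
  ext r
  obtain ⟨s, rfl⟩ : ∃ s, r = s + 1 := ⟨r - 1, by ring⟩
  rw [HahnSeries.coeff_single_mul_add, HahnSeries.coeff_mul_single_add, one_mul, mul_one]

theorem dduHom_mul (f g : LaurentInv A) :
    dduHom A (f * g) = dduHom A f * g + f * dduHom A g := by
  rw [dduHom_eq_left, eulerHom_mul, mul_add, dduHom_eq_left, dduHom_eq_left, ← mul_assoc,
    ← mul_assoc, single_mul_comm A f, mul_assoc f]

/-- The derivation `d/du` of `A((u⁻¹))`. -/
def ddu : RingDeriv (LaurentInv A) where
  toHom := dduHom A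
  leibniz := dduHom_mul A

end Laurent

section Resolvent

variable (A : Type*) [Ring A] [Algebra ℂ A]

/-- The expansion `∑_{r ≥ 1} L ^ (r - 1) u ^ (-r)` of `(u - L)⁻¹`. -/
def resolventSeries (L : ℂ) : LaurentInv A :=
  HahnSeries.ofSuppBddBelow
    (fun r : ℤ => if 1 ≤ r then algebraMap ℂ A (L ^ (r - 1).toNat) else 0) <| by
      refine ⟨1, fun x h => ?_⟩
      contrapose! h
      rw [Function.notMem_support, if_neg (not_le.mpr h)]

theorem resolventSeries_coeff (L : ℂ) (r : ℤ) : (resolventSeries A L).coeff r =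
    if 1 ≤ r then algebraMap ℂ A (L ^ (r - 1).toNat) else 0 := rfl

theorem resolventSeries_rec (L : ℂ) (r : ℤ) :
    (resolventSeries A L).coeff (r + 1) - algebraMap ℂ A L * (resolventSeries A L).coeff r
      = (1 : LaurentInv A).coeff r := by
  rw [HahnSeries.coeff_one, resolventSeries_coeff, resolventSeries_coeff]
  rcases lt_trichotomy r 0 with h | h | h
  · rw [if_neg (by omega), if_neg (by omega), if_neg (by omega), mul_zero, sub_zero]
  · subst h
    simp
  · obtain ⟨t, rfl⟩ : ∃ t : ℕ, r = t + 1 := ⟨(r - 1).toNat, by omega⟩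
    rw [if_pos (by omega), if_pos (by omega), if_neg (by omega), ← map_mul, ← pow_succ',
      show ((t : ℤ) + 1 + 1 - 1).toNat = t + 1 by omega, show ((t : ℤ) + 1 - 1).toNat = t by omega,
      sub_self]

theorem uSub_mul_resolventSeries (L : ℂ) :
    (uVar A - HahnSeries.C (algebraMap ℂ A L)) * resolventSeries A L = 1 := by
  ext r
  have h := HahnSeries.coeff_single_mul_add (r := (1 : A)) (x := resolventSeries A L)
    (a := r + 1) (b := (-1 : ℤ))
  rw [add_neg_cancel_right, one_mul] at h
  rw [sub_mul, HahnSeries.coeff_sub, uVar, h, HahnSeries.C_apply,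
    HahnSeries.coeff_single_zero_mul, resolventSeries_rec]

theorem resolventSeries_mul_uSub (L : ℂ) :
    resolventSeries A L * (uVar A - HahnSeries.C (algebraMap ℂ A L)) = 1 := by
  ext r
  have h := HahnSeries.coeff_mul_single_add (r := (1 : A)) (x := resolventSeries A L)
    (a := r + 1) (b := (-1 : ℤ))
  rw [add_neg_cancel_right, mul_one] at h
  rw [mul_sub, HahnSeries.coeff_sub, uVar, h, HahnSeries.C_apply,
    HahnSeries.coeff_mul_single_zero, ← Algebra.commutes, resolventSeries_rec]

/-- `u - L` as an invertible element of `A((u⁻¹))`. -/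
def uSub (L : ℂ) : (LaurentInv A)ˣ where
  val := uVar A - HahnSeries.C (algebraMap ℂ A L)
  inv := resolventSeries A L
  val_inv := uSub_mul_resolventSeries A L
  inv_val := resolventSeries_mul_uSub A L

end Resolvent

/-! ### The superalgebra `𝒟` -/

/-- The parity of the index `i` (numbered from `0`): even for the first `m` indices, odd for the
last `n`. -/
def IsOdd (m : ℕ) {n : ℕ} (i : Fin (m + n)) : Prop := m ≤ (i : ℕ)

instance (m : ℕ) {n : ℕ} (i : Fin (m + n)) : Decidable (IsOdd m i) :=
  inferInstanceAs (Decidable (m ≤ (i : ℕ)))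

/-- `(-1) ^ (parity i * parity j)`. -/
def superSign (m : ℕ) {n : ℕ} (i j : Fin (m + n)) : ℂ := if IsOdd m i ∧ IsOdd m j then -1 else 1

/-- The generators `x_{i,a}` and `∂_{i,a}`. -/
inductive Gen (m n k : ℕ) : Type
  | x : Fin (m + n) → Fin k → Gen m n k
  | d : Fin (m + n) → Fin k → Gen m n k

/-- The defining relations: the supercommutators `[x_{i,a}, x_{j,b}]` and `[∂_{i,a}, ∂_{j,b}]`
vanish and `[∂_{i,a}, x_{j,b}] = δ_{ij} δ_{ab}`. -/
inductive SuperRel (m n k : ℕ) :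
    FreeAlgebra ℂ (Gen m n k) → FreeAlgebra ℂ (Gen m n k) → Prop
  | xx (i j : Fin (m + n)) (a b : Fin k) : SuperRel m n k
      (FreeAlgebra.ι ℂ (Gen.x i a) * FreeAlgebra.ι ℂ (Gen.x j b)
        - superSign m i j • (FreeAlgebra.ι ℂ (Gen.x j b) * FreeAlgebra.ι ℂ (Gen.x i a))) 0
  | dd (i j : Fin (m + n)) (a b : Fin k) : SuperRel m n k
      (FreeAlgebra.ι ℂ (Gen.d i a) * FreeAlgebra.ι ℂ (Gen.d j b)
        - superSign m i j • (FreeAlgebra.ι ℂ (Gen.d j b) * FreeAlgebra.ι ℂ (Gen.d i a))) 0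
  | dx (i j : Fin (m + n)) (a b : Fin k) : SuperRel m n k
      (FreeAlgebra.ι ℂ (Gen.d i a) * FreeAlgebra.ι ℂ (Gen.x j b)
        - superSign m i j • (FreeAlgebra.ι ℂ (Gen.x j b) * FreeAlgebra.ι ℂ (Gen.d i a)))
      (if i = j ∧ a = b then 1 else 0)

/-- The superalgebra `𝒟`, given by generators and relations. -/
abbrev SuperWeyl (m n k : ℕ) : Type := RingQuot (SuperRel m n k)

/-- The algebra `𝒟((u⁻¹))[∂_u]`. -/
abbrev DOp (m n k : ℕ) : Type := DiffOp (ddu (SuperWeyl m n k))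

section Elements

variable (m n k : ℕ)

/-- The inclusion of `𝒟` in `𝒟((u⁻¹))[∂_u]`. -/
def incl : SuperWeyl m n k →+* DOp m n k :=
  (DiffOp.const (ddu (SuperWeyl m n k))).comp HahnSeries.C

variable {k}

/-- `x_{i,a}` -/
def X (i : Fin (m + n)) (a : Fin k) : DOp m n k :=
  incl m n k (RingQuot.mkAlgHom ℂ (SuperRel m n k) (FreeAlgebra.ι ℂ (Gen.x i a)))

/-- `∂_{i,a}` -/
def D (i : Fin (m + n)) (a : Fin k) : DOp m n k :=
  incl m n k (RingQuot.mkAlgHom ℂ (SuperRel m n k) (FreeAlgebra.ι ℂ (Gen.d i a)))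

variable (k)

/-- `(u - L)⁻¹` -/
def resolvent (L : ℂ) : DOp m n k :=
  DiffOp.const (ddu (SuperWeyl m n k))
    ((uSub (SuperWeyl m n k) L)⁻¹ : (LaurentInv (SuperWeyl m n k))ˣ)

/-- `∂_u - c` -/
def delSub (c : ℂ) : DOp m n k :=
  DiffOp.del (ddu (SuperWeyl m n k)) - incl m n k (algebraMap ℂ (SuperWeyl m n k) c)

variable {k}

/-- The matrix `G(Λ, z)`. -/
def G (Λ : Fin (m + n) → ℂ) (z : Fin k → ℂ) : Matrix (Fin k) (Fin k) (DOp m n k) :=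
  Matrix.of fun a b => (if a = b then delSub m n k (z a) else 0)
    - ∑ i : Fin (m + n), X m n i a * D m n i b * resolvent m n k (Λ i)

end Elements

/-- The product `f a_1 * f a_2 * ⋯ * f a_l` for `s = {a_1 < a_2 < ⋯ < a_l}`. -/
def orderedProd {k : ℕ} {R : Type*} [Ring R] (s : Finset (Fin k)) (f : Fin k → R) : R :=
  ((s.sort (· ≤ ·)).map f).prod

/-- The column determinant `∑ σ, sgn σ • A (σ 1) 1 * A (σ 2) 2 * ⋯ * A (σ k) k`. -/
def cdet {k : ℕ} {R : Type*} [Ring R] (A : Matrix (Fin k) (Fin k) R) : R :=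
  ∑ σ : Equiv.Perm (Fin k),
    ((Equiv.Perm.sign σ : ℤˣ) : ℤ) • (List.ofFn fun a => A (σ a) a).prod

/-! ### The index sets and the signs -/

section Combinatorics

variable {m n k : ℕ}

/-- The number of elements of `j⁻¹(i)`. -/
def fiberCard (j : Fin k → Option (Fin (m + n))) (i : Fin (m + n)) : ℕ :=
  (Finset.univ.filter fun a => j a = some i).card

/-- The set `J(𝔞)`. The value `0` of a function is written `none`. -/
def J (m n : ℕ) {k : ℕ} (𝔞 : Finset (Fin k)) : Finset (Fin k → Option (Fin (m + n))) :=
  Finset.univ.filter fun j =>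
    (∀ a, j a = none ↔ a ∉ 𝔞) ∧ ∀ i, ¬ IsOdd m i → fiberCard j i ≤ 1

/-- The relation `j₁ ~ j₂`. -/
def Sim (j₁ j₂ : Fin k → Option (Fin (m + n))) : Prop :=
  ∀ i, fiberCard j₁ i = fiberCard j₂ i

instance (j₁ j₂ : Fin k → Option (Fin (m + n))) : Decidable (Sim j₁ j₂) :=
  inferInstanceAs (Decidable (∀ i, fiberCard j₁ i = fiberCard j₂ i))

/-- `σ` is a permutation of `{a | j₂ a ≠ 0}` (extended by the identity to the complement) that
maps `j₂⁻¹(i)` to `j₁⁻¹(i)` increasingly for every `i ≠ 0`. -/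
def IsConnecting (j₁ j₂ : Fin k → Option (Fin (m + n))) (σ : Equiv.Perm (Fin k)) : Prop :=
  (∀ a, j₂ a = none → σ a = a) ∧ (∀ a, j₁ (σ a) = j₂ a) ∧
    ∀ i a b, j₂ a = some i → j₂ b = some i → a < b → σ a < σ b

theorem existsUnique_isConnecting (𝔞 : Finset (Fin k)) (j₁ j₂ : Fin k → Option (Fin (m + n)))
    (h₁ : j₁ ∈ J m n 𝔞) (h₂ : j₂ ∈ J m n 𝔞) (h : Sim j₁ j₂) :
    ∃! σ : Equiv.Perm (Fin k), IsConnecting j₁ j₂ σ := by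
  have h₁' := (Finset.mem_filter.mp h₁).2.1
  have h₂' := (Finset.mem_filter.mp h₂).2.1
  have key : ∀ o : Option (Fin (m + n)), ∃ e : {a // j₂ a = o} ≃ {a // j₁ a = o},
      StrictMono e ∧ (o = none → ∀ a, ((e a : Fin k)) = a) := by
    intro o
    cases o with
    | none =>
      refine ⟨Equiv.subtypeEquivRight fun a => (h₂' a).trans (h₁' a).symm, fun a b hab => hab,
        fun _ a => rfl⟩
    | some i =>
      have c₁ : Fintype.card {a // j₁ a = some i} = fiberCard j₁ i := Fintype.card_subtype _
      have c₂ : Fintype.card {a // j₂ a = some i} = fiberCard j₁ i :=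
        (Fintype.card_subtype _).trans (h i).symm
      let e := (Fintype.orderIsoFinOfCardEq _ c₂).symm.trans (Fintype.orderIsoFinOfCardEq _ c₁)
      exact ⟨e.toEquiv, e.strictMono, fun h => by cases h⟩
  choose e he he' using key
  let σ : Equiv.Perm (Fin k) :=
    (Equiv.sigmaFiberEquiv j₂).symm.trans
      ((Equiv.sigmaCongrRight e).trans (Equiv.sigmaFiberEquiv j₁))
  have hσ : ∀ a o (ha : j₂ a = o), σ a = e o ⟨a, ha⟩ := by
    rintro a o rfl
    rfl
  refine ⟨σ, ⟨fun a ha => ?_, fun a => ?_, fun i a b ha hb hab => ?_⟩, ?_⟩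
  · rw [hσ a none ha, he' none rfl]
  · rw [hσ a _ rfl]
    exact (e (j₂ a) ⟨a, rfl⟩).2
  · rw [hσ a _ ha, hσ b _ hb]
    exact he (some i) (show (⟨a, ha⟩ : {a // j₂ a = some i}) < ⟨b, hb⟩ from hab)
  · rintro τ ⟨t1, t2, t3⟩
    ext1 a
    rcases ho : j₂ a with _ | i
    · rw [t1 a ho, hσ a none ho, he' none rfl]
    · -- two increasing bijections between finite chains agree
      let f : {a // j₂ a = some i} → {a // j₁ a = some i} := fun b => ⟨τ b, (t2 b).trans b.2⟩
      have hf : StrictMono f := fun b c hbc => t3 i b c b.2 c.2 hbc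
      have hfs : Function.Surjective f := by
        rintro ⟨b, hb⟩
        refine ⟨⟨τ.symm b, ?_⟩, Subtype.ext (τ.apply_symm_apply b)⟩
        rw [← t2, τ.apply_symm_apply, hb]
      have hr : (hf.orderIsoOfSurjective f hfs) =
          ((he (some i)).orderIsoOfSurjective _ (e (some i)).surjective) := Subsingleton.elim _ _
      have := congrArg Subtype.val (DFunLike.congr_fun hr ⟨a, ho⟩)
      rw [hσ a _ ho]
      exact this

open Classical in
/-- The permutation `σ_{j₁,j₂}`, for `j₁ ~ j₂` in `J(𝔞)`. -/
def connecting (j₁ j₂ : Fin k → Option (Fin (m + n))) : Equiv.Perm (Fin k) :=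
  if h : ∃ σ : Equiv.Perm (Fin k), IsConnecting j₁ j₂ σ then h.choose else 1

/-- `j a` is an odd index (so `j a ≠ 0`). -/
def OddAt (j : Fin k → Option (Fin (m + n))) (a : Fin k) : Prop :=
  ∃ i, j a = some i ∧ IsOdd m i

instance (j : Fin k → Option (Fin (m + n))) (a : Fin k) : Decidable (OddAt j a) :=
  inferInstanceAs (Decidable (∃ i, j a = some i ∧ IsOdd m i))

/-- `sgn(j₁, j₂)`: the parity of the number of pairs of odd positions of `j₂` that are not inverted
by `σ_{j₁,j₂}`. -/
def pairSign (j₁ j₂ : Fin k → Option (Fin (m + n))) : ℤ :=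
  (-1) ^ (Finset.univ.filter fun p : Fin k × Fin k =>
    p.1 < p.2 ∧ connecting j₁ j₂ p.1 < connecting j₁ j₂ p.2 ∧ OddAt j₂ p.1 ∧ OddAt j₂ p.2).card

/-- `c(j₁, j₂) = sgn(j₁, j₂) sgn(σ_{j₁,j₂}) (-1) ^ |𝔞|`. -/
def coeffSign (𝔞 : Finset (Fin k)) (j₁ j₂ : Fin k → Option (Fin (m + n))) : ℤ :=
  pairSign j₁ j₂ * ((Equiv.Perm.sign (connecting j₁ j₂) : ℤˣ) : ℤ) * (-1) ^ 𝔞.card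

/-- `∏_{i odd} |j⁻¹(i)|!` -/
def oddFactorials (j : Fin k → Option (Fin (m + n))) : ℤ :=
  ∏ i ∈ Finset.univ.filter (fun i : Fin (m + n) => IsOdd m i), ((fiberCard j i).factorial : ℤ)

/-- `f (j a) a`, for `j a ≠ 0`. -/
def atIndex {R : Type*} [Ring R] (f : Fin (m + n) → Fin k → R)
    (j : Fin k → Option (Fin (m + n))) (a : Fin k) : R :=
  match j a with
  | some i => f i a
  | none => 1

/-- `x_j = x_{j(a_1),a_1} ⋯ x_{j(a_l),a_l}` -/
def xProd (𝔞 : Finset (Fin k)) (j : Fin k → Option (Fin (m + n))) : DOp m n k :=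
  orderedProd 𝔞 (atIndex (X m n) j)

/-- `∂_j = ∂_{j(a_1),a_1} ⋯ ∂_{j(a_l),a_l}` -/
def dProd (𝔞 : Finset (Fin k)) (j : Fin k → Option (Fin (m + n))) : DOp m n k :=
  orderedProd 𝔞 (atIndex (D m n) j)

/-- `∏_{a ∈ 𝔞} (u - Λ_{j(a)})⁻¹` -/
def resolventProd (Λ : Fin (m + n) → ℂ) (𝔞 : Finset (Fin k))
    (j : Fin k → Option (Fin (m + n))) : DOp m n k :=
  orderedProd 𝔞 (atIndex (fun i _ => resolvent m n k (Λ i)) j)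

/-- `∏_{a ∉ 𝔞} (∂_u - z_a)` -/
def delProd (m n : ℕ) (z : Fin k → ℂ) (𝔞 : Finset (Fin k)) : DOp m n k :=
  orderedProd 𝔞ᶜ (fun a => delSub m n k (z a))

end Combinatorics

end CapelliSuper

end

/-!
The entries of `G(Λ, z)` are `δ_{cr} (∂_u - z_r) - ∑ i, x_{i,c} ∂_{i,r} (u - Λ_i)⁻¹`. The normally
ordered product of such an entry with an even normally ordered element `q` is obtained without any
sign by enclosing `q`: it is `δ_{cr} q (∂_u - z_r) - ∑ i, (u - Λ_i)⁻¹ x_{i,c} q ∂_{i,r}`. This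
defines operators `normalInsert c r`, and the difference between multiplication by the entry and
`normalInsert c r` is the operator `q ↦ δ_{cr} [∂_u, q] - ∑ i, (u - Λ_i)⁻¹ x_{i,c} [∂_{i,r}, q]`,
which annihilates `1`.

The commutator of this difference, for the entry `(c, r)`, with `normalInsert c' r'` consists of the
derivative of the resolvents (present for `c = r`) and of the contraction of `∂_{i,r}` with
`x_{i,c'}` (present for `c' = r`); the two are exchanged by `c ↔ c'` (`commutator_normalInsert`). So under the
antisymmetrization over the rows the difference can be moved to the right through all later columns
until it meets `1` and vanishes (`antisymSum_congr`): in the column determinant all products may be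
replaced by normally ordered ones (`cdet_capelliMatrix`).

Expanding the normally ordered products gives a sum over `σ` and a choice `j` of an index (or of
`∂_u - z_a`, encoded as `none`) in every column. Sorting the `x` and reversing the `∂` produces the
sign `koszulSign j σ` (`cdet_eq_sum_normalProd`), and the monomial depends only on `j₁ = j ∘ σ⁻¹`
and `j₂ = j`. For given `j₁` and `j₂` the possible `σ` differ by permutations preserving the fibres of
`j₂`. Exchanging two positions in an even fibre changes the sign of the summand, so repeated even
values cancel (`sum_carries_eq_zero`); permuting odd positions does not change it
(`sign_mul_koszulSign_mul`), so that the odd fibres contribute the factorials (`sum_carries_eq`).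
-/

noncomputable section

namespace CapelliSuper

/-! ### Antisymmetrized products of operators -/

section Antisym

variable {ι M : Type*} {l : ℕ}

/-- A weight on `l`-tuples of rows that changes sign when two entries are exchanged. -/
def IsAntisymm (ε : (Fin l → ι) → ℤ) : Prop :=
  ∀ (f : Fin l → ι) (i j : Fin l), i ≠ j → ε (f ∘ Equiv.swap i j) = -ε f

theorem cons_comp_swap (c : ι) (f : Fin l → ι) (i j : Fin l) :
    (Fin.cons c (f ∘ Equiv.swap i j) : Fin (l + 1) → ι)
      = (Fin.cons c f : Fin (l + 1) → ι) ∘ Equiv.swap i.succ j.succ := by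
  funext a
  refine Fin.cases ?_ (fun b => ?_) a
  · simp [Equiv.swap_apply_of_ne_of_ne (Fin.succ_ne_zero i).symm (Fin.succ_ne_zero j).symm]
  · rw [Function.comp_apply, Fin.cons_succ, Function.comp_apply,
      (Fin.succ_injective l).swap_apply, Fin.cons_succ]

theorem cons_cons_swap (c c' : ι) (f : Fin l → ι) :
    (Fin.cons c' (Fin.cons c f : Fin (l + 1) → ι) : Fin (l + 2) → ι)
      = (Fin.cons c (Fin.cons c' f : Fin (l + 1) → ι) : Fin (l + 2) → ι) ∘ Equiv.swap 0 1 := by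
  funext a
  refine Fin.cases ?_ (fun b => Fin.cases ?_ (fun b => ?_) b) a
  · simp
  · rw [show (Fin.succ 0 : Fin (l + 2)) = 1 from rfl]
    simp
  · have h0 : b.succ.succ ≠ (0 : Fin (l + 2)) := Fin.succ_ne_zero _
    have h1 : b.succ.succ ≠ (1 : Fin (l + 2)) := fun h =>
      Fin.succ_ne_zero b (Fin.succ_injective _ h)
    simp [Equiv.swap_apply_of_ne_of_ne h0 h1]

theorem IsAntisymm.cons {ε : (Fin (l + 1) → ι) → ℤ} (h : IsAntisymm ε) (c : ι) :
    IsAntisymm fun f : Fin l → ι => ε (Fin.cons c f) := by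
  intro f i j hij
  change ε _ = -ε _
  rw [cons_comp_swap, h _ _ _ ((Fin.succ_injective l).ne hij)]

theorem IsAntisymm.cons_cons {ε : (Fin (l + 2) → ι) → ℤ} (h : IsAntisymm ε) (c c' : ι)
    (f : Fin l → ι) :
    ε (Fin.cons c' (Fin.cons c f : Fin (l + 1) → ι))
      = -ε (Fin.cons c (Fin.cons c' f : Fin (l + 1) → ι)) := by
  rw [cons_cons_swap, h _ _ _ (by simp)]

variable [Fintype ι] [AddCommGroup M]

/-- The vector `∑ f, ε f • A₀ (f 0) (A₁ (f 1) (⋯ v))`, where `A a` is the `a`-th column of operators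
and `f` chooses a row in each column. -/
def antisymSum : (l : ℕ) → (Fin l → ι → AddMonoid.End M) → ((Fin l → ι) → ℤ) → M → M
  | 0, _, ε, v => ε Fin.elim0 • v
  | l + 1, A, ε, v =>
    ∑ c, A 0 c (antisymSum l (fun a => A a.succ) (fun f => ε (Fin.cons c f)) v)

theorem antisymSum_neg (A : Fin l → ι → AddMonoid.End M) (ε : (Fin l → ι) → ℤ) (v : M) :
    antisymSum l A (fun f => -ε f) v = -antisymSum l A ε v := by
  induction l with
  | zero => simp [antisymSum]
  | succ l ih => simp [antisymSum, ih (fun a => A a.succ)]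

theorem antisymSum_zero (A : Fin l → ι → AddMonoid.End M) (v : M) :
    antisymSum l A (fun _ => 0) v = 0 := by
  induction l with
  | zero => simp [antisymSum]
  | succ l ih => simp [antisymSum, ih (fun a => A a.succ)]

/-- A column `V` that annihilates `v` and whose commutators with the columns `N a` are symmetric in
the two rows can be moved to the right inside an antisymmetrized product, where it vanishes. -/
theorem sum_apply_antisymSum_eq_zero (V : ι → AddMonoid.End M) (N : Fin l → ι → AddMonoid.End M)
    (v : M) (hV : ∀ c, V c v = 0)
    (hVN : ∀ a c c' q, V c (N a c' q) - N a c' (V c q) = V c' (N a c q) - N a c (V c' q))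
    (ε : (Fin (l + 1) → ι) → ℤ) (hε : IsAntisymm ε) :
    ∑ c, V c (antisymSum l N (fun f => ε (Fin.cons c f)) v) = 0 := by
  induction l with
  | zero => simp [antisymSum, map_zsmul, hV]
  | succ l ih =>
    let S : ι → ι → M := fun c c' => antisymSum l (fun a => N a.succ)
      (fun f => ε (Fin.cons c (Fin.cons c' f : Fin (l + 1) → ι))) v
    have hS : ∀ c c', S c' c = -S c c' := by
      intro c c'
      rw [← antisymSum_neg]
      exact congrArg (fun w => antisymSum l _ w v) (funext (hε.cons_cons c c'))
    have hSS : ∀ c, S c c = 0 := by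
      intro c
      have h0 : (fun f : Fin l → ι => ε (Fin.cons c (Fin.cons c f : Fin (l + 1) → ι)))
          = fun _ => 0 := by
        funext f
        have := hε.cons_cons c c f
        omega
      change antisymSum l _ (fun f : Fin l → ι => ε (Fin.cons c (Fin.cons c f : Fin (l + 1) → ι))) v
        = 0
      rw [h0, antisymSum_zero]
    -- Once `V` stands behind the first column, the induction hypothesis applies.
    have h1 : ∑ c, ∑ c', N 0 c' (V c (S c c')) = 0 := by
      rw [Finset.sum_comm]
      refine Finset.sum_eq_zero fun c' _ => ?_
      rw [← map_sum, show ∑ c, V c (S c c') = -∑ c, V c (S c' c) by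
        rw [← Finset.sum_neg_distrib]
        exact Finset.sum_congr rfl fun c _ => by rw [hS, map_neg],
        ih (fun a => N a.succ) (fun a => hVN a.succ) _ (hε.cons c'), neg_zero, map_zero]
    -- The commutators are symmetric in `c`, `c'` and `S` is antisymmetric.
    have h2 : ∑ c, ∑ c', (V c (N 0 c' (S c c')) - N 0 c' (V c (S c c'))) = 0 := by
      rw [← Fintype.sum_prod_type' (f := fun c c' =>
        V c (N 0 c' (S c c')) - N 0 c' (V c (S c c')))]
      refine Finset.sum_involution (fun p _ => p.swap) ?_ ?_ (by simp) (by simp)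
      · rintro ⟨c, c'⟩ -
        change _ + (V c' (N 0 c (S c' c)) - N 0 c (V c' (S c' c))) = 0
        rw [hVN 0 c' c, hS, map_neg, map_neg, map_neg, map_neg]
        abel
      · rintro ⟨c, c'⟩ - hne h
        obtain rfl : c' = c := congrArg Prod.fst h
        exact hne (by simp [hSS])
    calc _ = ∑ c, ∑ c', V c (N 0 c' (S c c')) :=
          Finset.sum_congr rfl fun c _ => map_sum (V c) _ _
      _ = ∑ c, ∑ c', (V c (N 0 c' (S c c')) - N 0 c' (V c (S c c')))
          + ∑ c, ∑ c', N 0 c' (V c (S c c')) := by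
        rw [← Finset.sum_add_distrib]
        refine Finset.sum_congr rfl fun c _ => ?_
        rw [← Finset.sum_add_distrib]
        exact Finset.sum_congr rfl fun c' _ => (sub_add_cancel _ _).symm
      _ = 0 := by rw [h1, h2, add_zero]

/-- In an antisymmetrized product each column `G a` can be replaced by `N a` if the differences
annihilate `v` and their commutators with the later columns `N b` are symmetric in the rows. -/
theorem antisymSum_congr (G N : Fin l → ι → AddMonoid.End M) (v : M)
    (hv : ∀ a c, G a c v = N a c v)
    (hGN : ∀ a b c c' q, a < b →
      (G a c - N a c) (N b c' q) - N b c' ((G a c - N a c) q)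
        = (G a c' - N a c') (N b c q) - N b c ((G a c' - N a c') q))
    (ε : (Fin l → ι) → ℤ) (hε : IsAntisymm ε) :
    antisymSum l G ε v = antisymSum l N ε v := by
  induction l with
  | zero => rfl
  | succ l ih =>
    have h := sum_apply_antisymSum_eq_zero (fun c => G 0 c - N 0 c) (fun a => N a.succ) v
      (fun c => sub_eq_zero.mpr (hv 0 c)) (fun a c c' q => hGN 0 a.succ c c' q (Fin.succ_pos a)) ε hε
    have hsub : ∀ (f g : AddMonoid.End M) q, (f - g) q = f q - g q := fun _ _ _ => rfl
    simp only [hsub, Finset.sum_sub_distrib] at h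
    rw [antisymSum, antisymSum, ← sub_eq_zero, ← h]
    congr 1
    refine Finset.sum_congr rfl fun c _ => ?_
    rw [ih (fun a => G a.succ) (fun a => N a.succ) (fun a => hv a.succ)
      (fun a b c c' q hab => hGN a.succ b.succ c c' q (Fin.succ_lt_succ_iff.mpr hab)) _ (hε.cons c)]

theorem antisymSum_eq_sum (A : Fin l → ι → AddMonoid.End M) (ε : (Fin l → ι) → ℤ) (v : M) :
    antisymSum l A ε v = ∑ f, ε f • (List.ofFn fun a => A a (f a)).prod v := by
  induction l with
  | zero =>
    rw [Fintype.sum_unique, antisymSum, Subsingleton.elim Fin.elim0 default]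
    simp
  | succ l ih =>
    rw [antisymSum, ← (Fin.consEquiv fun _ => ι).sum_comp, Fintype.sum_prod_type]
    refine Finset.sum_congr rfl fun c _ => ?_
    rw [ih, map_sum]
    refine Finset.sum_congr rfl fun f _ => ?_
    rw [map_zsmul, List.ofFn_succ, List.prod_cons]
    rfl

/-- The weight that is `sgn σ` on a permutation `σ` and `0` on the other functions. -/
def permWeight {k : ℕ} (f : Fin k → Fin k) : ℤ :=
  ∑ σ : Equiv.Perm (Fin k), if f = σ then ((Equiv.Perm.sign σ : ℤˣ) : ℤ) else 0

theorem isAntisymm_permWeight {k : ℕ} : IsAntisymm (permWeight (k := k)) := by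
  intro f i j hij
  rw [permWeight, permWeight, ← Equiv.sum_comp (Equiv.mulRight (Equiv.swap i j)),
    ← Finset.sum_neg_distrib]
  refine Finset.sum_congr rfl fun σ _ => ?_
  have h : f ∘ Equiv.swap i j = (σ * Equiv.swap i j : Equiv.Perm (Fin k)) ↔ f = σ := by
    rw [Equiv.Perm.coe_mul]
    exact (Equiv.swap i j).surjective.injective_comp_right.eq_iff
  rw [Equiv.coe_mulRight, if_congr h rfl rfl, Equiv.Perm.sign_mul, Equiv.Perm.sign_swap hij]
  split_ifs <;> simp

theorem antisymSum_permWeight {k : ℕ} (A : Fin k → Fin k → AddMonoid.End M) (v : M) :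
    antisymSum k A permWeight v = ∑ σ : Equiv.Perm (Fin k),
      ((Equiv.Perm.sign σ : ℤˣ) : ℤ) • (List.ofFn fun a => A a (σ a)).prod v := by
  simp only [antisymSum_eq_sum, permWeight, Finset.sum_smul, ite_smul, zero_smul]
  rw [Finset.sum_comm]
  refine Finset.sum_congr rfl fun σ _ => ?_
  rw [Finset.sum_ite_eq']
  simp

end Antisym

/-! ### Normal ordering of the column determinant -/

/-- `(-1) ^ (parity i * parity j)` as an integer. -/
def paritySign (m : ℕ) {n : ℕ} (i j : Fin (m + n)) : ℤ := if IsOdd m i ∧ IsOdd m j then -1 else 1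

theorem paritySign_comm (m : ℕ) {n : ℕ} (i j : Fin (m + n)) :
    paritySign m i j = paritySign m j i := by
  simp only [paritySign, and_comm]

theorem paritySign_mul_self (m : ℕ) {n : ℕ} (i j : Fin (m + n)) :
    paritySign m i j * paritySign m i j = 1 := by
  unfold paritySign
  split_ifs <;> rfl

/-- The relations among `x i a = x_{i,a}`, `d i a = ∂_{i,a}`, `w i = (u - Λ_i)⁻¹` and
`e a = ∂_u - z_a` in a ring `R`. These are all that the normal ordering of the determinant uses. -/
structure IsCapelliSystem (m : ℕ) {n k : ℕ} {R : Type*} [Ring R] (x d : Fin (m + n) → Fin k → R)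
    (w : Fin (m + n) → R) (e : Fin k → R) : Prop where
  xx : ∀ i j a b, x i a * x j b = paritySign m i j • (x j b * x i a)
  dd : ∀ i j a b, d i a * d j b = paritySign m i j • (d j b * d i a)
  dx : ∀ i j a b, d i a * x j b
    = paritySign m i j • (x j b * d i a) + if i = j ∧ a = b then 1 else 0
  ww : ∀ i j, Commute (w i) (w j)
  wx : ∀ i j a, Commute (w i) (x j a)
  wd : ∀ i j a, Commute (w i) (d j a)
  ee : ∀ a b, Commute (e a) (e b)
  ex : ∀ a j b, Commute (e a) (x j b)
  ed : ∀ a j b, Commute (e a) (d j b)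
  ew : ∀ a i, e a * w i = w i * e a - w i * w i

section NormalOrdering

variable {m n k : ℕ} {R : Type*} [Ring R]

/-- The matrix `δ_{cr} e_r - ∑ i, x_{i,c} ∂_{i,r} w_i`. -/
def capelliMatrix (x d : Fin (m + n) → Fin k → R) (w : Fin (m + n) → R) (e : Fin k → R) :
    Matrix (Fin k) (Fin k) R :=
  Matrix.of fun c r => (if c = r then e c else 0) - ∑ i, x i c * d i r * w i

/-- The operator `q ↦ w_i x_{i,c} q ∂_{i,r}`. On a normally ordered even `q` it is the normally
ordered product of `x_{i,c} ∂_{i,r} w_i` with `q`. -/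
def sandwich (x d : Fin (m + n) → Fin k → R) (w : Fin (m + n) → R) (i : Fin (m + n))
    (c r : Fin k) : AddMonoid.End R :=
  AddMonoid.End.mulLeft (w i * x i c) * AddMonoid.End.mulRight (d i r)

/-- The operator of normally ordered multiplication by the entry `(c, r)` of `capelliMatrix`. -/
def normalInsert (x d : Fin (m + n) → Fin k → R) (w : Fin (m + n) → R) (e : Fin k → R)
    (c r : Fin k) : AddMonoid.End R :=
  (if c = r then AddMonoid.End.mulRight (e r) else 0) - ∑ i, sandwich x d w i c r

/-- The operator `q ↦ w_i x_{i,c} [∂_{i,r}, q]`. -/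
def contraction (x d : Fin (m + n) → Fin k → R) (w : Fin (m + n) → R) (i : Fin (m + n))
    (c r : Fin k) : AddMonoid.End R :=
  AddMonoid.End.mulLeft (w i * x i c) *
    (AddMonoid.End.mulLeft (d i r) - AddMonoid.End.mulRight (d i r))

/-- The operator `q ↦ [e, q]`. -/
def innerDeriv (e : R) : AddMonoid.End R := AddMonoid.End.mulLeft e - AddMonoid.End.mulRight e

theorem contraction_apply (x d : Fin (m + n) → Fin k → R) (w : Fin (m + n) → R)
    (i : Fin (m + n)) (c r : Fin k) (q : R) :
    contraction x d w i c r q = w i * x i c * (d i r * q - q * d i r) := rfl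

theorem innerDeriv_apply (e q : R) : innerDeriv e q = e * q - q * e := rfl

variable {x d : Fin (m + n) → Fin k → R} {w : Fin (m + n) → R} {e : Fin k → R}

namespace IsCapelliSystem

theorem mulLeft_sub_normalInsert (h : IsCapelliSystem m x d w e) (c r : Fin k) :
    (AddMonoid.End.mulLeft (capelliMatrix x d w e c r)) - normalInsert x d w e c r
      = (if c = r then innerDeriv (e r) else 0) - ∑ i, contraction x d w i c r := by
  have hG : (AddMonoid.End.mulLeft (capelliMatrix x d w e c r))
      = (if c = r then (AddMonoid.End.mulLeft (e r)) else 0)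
        - ∑ i, (contraction x d w i c r + sandwich x d w i c r) := by
    have hi : ∀ i, contraction x d w i c r + sandwich x d w i c r
        = (AddMonoid.End.mulLeft (x i c * d i r * w i)) := by
      intro i
      ext q
      change w i * x i c * (d i r * q - q * d i r) + w i * x i c * (q * d i r)
        = x i c * d i r * w i * q
      rw [← mul_add, sub_add_cancel, mul_assoc (x i c), ← (h.wd i i r).eq, ← mul_assoc (x i c),
        ← (h.wx i i c).eq]
      simp only [mul_assoc]
    rw [Finset.sum_congr rfl fun i _ => hi i]
    ext q
    have hs : (∑ i, (AddMonoid.End.mulLeft (x i c * d i r * w i))) q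
        = (∑ i, x i c * d i r * w i) * q := by
      rw [Finset.sum_mul]
      exact AddMonoidHom.finsetSum_apply _ _ _
    change capelliMatrix x d w e c r * q = _ - (∑ i, _ : AddMonoid.End R) q
    rw [hs, capelliMatrix, Matrix.of_apply, sub_mul]
    congr 1
    split_ifs with hcr
    · subst hcr
      rfl
    · exact zero_mul q
  rw [hG, normalInsert, Finset.sum_add_distrib]
  split_ifs
  · rw [innerDeriv]
    abel
  · abel

theorem innerDeriv_mul_sandwich (h : IsCapelliSystem m x d w e) (a : Fin k) (j : Fin (m + n))
    (c r : Fin k) :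
    innerDeriv (e a) * sandwich x d w j c r
      = sandwich x d w j c r * innerDeriv (e a)
        - AddMonoid.End.mulLeft (w j) * sandwich x d w j c r := by
  ext q
  change e a * (w j * x j c * (q * d j r)) - w j * x j c * (q * d j r) * e a
    = w j * x j c * ((e a * q - q * e a) * d j r) - w j * (w j * x j c * (q * d j r))
  have h1 : e a * (w j * x j c * (q * d j r))
      = w j * x j c * (e a * q * d j r) - w j * (w j * x j c * (q * d j r)) := by
    simp only [← mul_assoc]
    rw [h.ew, sub_mul, sub_mul, sub_mul, mul_assoc (w j) (e a), (h.ex a j c).eq]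
    simp only [mul_assoc]
  have h2 : w j * x j c * (q * d j r) * e a = w j * x j c * (q * e a * d j r) := by
    simp only [mul_assoc]
    rw [(h.ed a j r).eq]
  rw [h1, h2, sub_mul, mul_sub]
  abel

theorem contraction_mul_mulRight (h : IsCapelliSystem m x d w e) (i : Fin (m + n))
    (c r a : Fin k) :
    contraction x d w i c r * AddMonoid.End.mulRight (e a)
      = AddMonoid.End.mulRight (e a) * contraction x d w i c r := by
  ext q
  change w i * x i c * (d i r * (q * e a) - q * e a * d i r)
    = w i * x i c * (d i r * q - q * d i r) * e a
  rw [mul_assoc q, (h.ed a i r).eq, mul_assoc (w i * x i c), sub_mul]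
  simp only [mul_assoc]

theorem innerDeriv_mul_mulRight (h : IsCapelliSystem m x d w e) (a b : Fin k) :
    innerDeriv (e a) * AddMonoid.End.mulRight (e b)
      = AddMonoid.End.mulRight (e b) * innerDeriv (e a) := by
  ext q
  change e a * (q * e b) - q * e b * e a = (e a * q - q * e a) * e b
  rw [mul_assoc q, (h.ee b a).eq, sub_mul]
  simp only [mul_assoc]

/-- The sign from moving `∂_{i,r}` through `x_{j,c'}` and `∂_{j,r'}` is cancelled by the one from
moving `x_{i,c}` through `x_{j,c'}`, so only the contraction of `∂_{i,r}` with `x_{j,c'}` is left. -/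
theorem contraction_mul_sandwich (h : IsCapelliSystem m x d w e) (i j : Fin (m + n))
    (c r c' r' : Fin k) :
    contraction x d w i c r * sandwich x d w j c' r'
      = sandwich x d w j c' r' * contraction x d w i c r
        + if i = j ∧ r = c' then AddMonoid.End.mulLeft (w i) * sandwich x d w i c r' else 0 := by
  ext q
  change w i * x i c
      * (d i r * (w j * x j c' * (q * d j r')) - w j * x j c' * (q * d j r') * d i r)
    = w j * x j c' * (w i * x i c * (d i r * q - q * d i r) * d j r')
      + (if i = j ∧ r = c' then AddMonoid.End.mulLeft (w i) * sandwich x d w i c r' else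
        (0 : AddMonoid.End R)) q
  have h1 : d i r * (w j * x j c' * (q * d j r'))
      = paritySign m i j • (w j * x j c' * (d i r * q * d j r'))
        + w j * ((if i = j ∧ r = c' then 1 else 0) * (q * d j r')) := by
    rw [mul_assoc (w j), ← mul_assoc (d i r), ← (h.wd j i r).eq, mul_assoc (w j),
      ← mul_assoc (d i r), h.dx, add_mul, mul_add, smul_mul_assoc, mul_smul_comm]
    simp only [mul_assoc]
  have h2 : w j * x j c' * (q * d j r') * d i r
      = paritySign m i j • (w j * x j c' * (q * d i r * d j r')) := by
    rw [mul_assoc, mul_assoc q, h.dd j i, paritySign_comm, mul_smul_comm, mul_smul_comm]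
    simp only [mul_assoc]
  have h3 : paritySign m i j • (w i * x i c * (w j * x j c')) = w j * x j c' * (w i * x i c) := by
    rw [mul_assoc (w i), ← mul_assoc (x i c), ← (h.wx j i c).eq, mul_assoc (w j), h.xx i j,
      mul_smul_comm, mul_smul_comm, smul_smul, paritySign_mul_self, one_smul, ← mul_assoc (w i),
      (h.ww i j).eq, mul_assoc (w j), ← mul_assoc (w i), (h.wx i j c').eq]
    simp only [mul_assoc]
  rw [h1, h2, add_sub_right_comm, ← smul_sub, ← mul_sub, ← sub_mul, mul_add, mul_smul_comm,
    ← mul_assoc (w i * x i c) (w j * x j c'), ← smul_mul_assoc, h3]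
  congr 1
  · simp only [mul_assoc]
  · split_ifs with hij
    · obtain ⟨rfl, rfl⟩ := hij
      change w i * x i c * (w i * (1 * (q * d i r'))) = w i * (w i * x i c * (q * d i r'))
      rw [one_mul, ← mul_assoc, mul_assoc (w i), ← (h.wx i i c).eq]
      simp only [mul_assoc]
    · rw [zero_mul, mul_zero, mul_zero]
      rfl

/-- The commutator of the correction `capelliMatrix - normalInsert` in column `r` with the normally
ordered multiplication in column `r'`. It is symmetric in the rows `c` and `c'`: the contraction of
`∂_{i,r}` with `x_{i,c'}` (for `c' = r`) is matched by the derivative of `w_i` (for `c = r`). -/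
theorem commutator_normalInsert (h : IsCapelliSystem m x d w e) (c r c' r' : Fin k) :
    (AddMonoid.End.mulLeft (capelliMatrix x d w e c r) - normalInsert x d w e c r)
        * normalInsert x d w e c' r'
      - normalInsert x d w e c' r'
        * (AddMonoid.End.mulLeft (capelliMatrix x d w e c r) - normalInsert x d w e c r)
      = (if c = r then ∑ j, AddMonoid.End.mulLeft (w j) * sandwich x d w j c' r' else 0)
        + if c' = r then ∑ j, AddMonoid.End.mulLeft (w j) * sandwich x d w j c r'
          else (0 : AddMonoid.End R) := by
  rw [h.mulLeft_sub_normalInsert, normalInsert]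
  set A := ∑ j, sandwich x d w j c' r' with hA
  set B := ∑ i, contraction x d w i c r with hB
  have hBA : B * A = A * B + if c' = r then ∑ j, AddMonoid.End.mulLeft (w j) * sandwich x d w j c r'
      else (0 : AddMonoid.End R) := by
    have h1 : B * A = ∑ i, ∑ j, contraction x d w i c r * sandwich x d w j c' r' := by
      rw [hA, hB, Finset.sum_mul_sum]
    have h2 : A * B = ∑ i, ∑ j, sandwich x d w j c' r' * contraction x d w i c r := by
      rw [hA, hB, Finset.sum_mul_sum, Finset.sum_comm]
    have h3 : (if c' = r then ∑ j, AddMonoid.End.mulLeft (w j) * sandwich x d w j c r'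
        else (0 : AddMonoid.End R)) = ∑ i, ∑ j, if i = j ∧ r = c' then
          AddMonoid.End.mulLeft (w i) * sandwich x d w i c r' else (0 : AddMonoid.End R) := by
      split_ifs with hr
      · simp [hr]
      · simp [Ne.symm hr]
    rw [h1, h2, h3, ← Finset.sum_add_distrib]
    refine Finset.sum_congr rfl fun i _ => ?_
    rw [← Finset.sum_add_distrib]
    exact Finset.sum_congr rfl fun j _ => h.contraction_mul_sandwich i j c r c' r'
  have hBE : B * AddMonoid.End.mulRight (e r') = AddMonoid.End.mulRight (e r') * B := by
    rw [hB, Finset.sum_mul, Finset.mul_sum]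
    exact Finset.sum_congr rfl fun i _ => h.contraction_mul_mulRight i c r r'
  have hUA : innerDeriv (e r) * A = A * innerDeriv (e r)
      - ∑ j, AddMonoid.End.mulLeft (w j) * sandwich x d w j c' r' := by
    rw [hA, Finset.mul_sum, Finset.sum_mul, ← Finset.sum_sub_distrib]
    exact Finset.sum_congr rfl fun j _ => h.innerDeriv_mul_sandwich r j c' r'
  have hUE := h.innerDeriv_mul_mulRight r r'
  have key : ∀ (p p' : Prop) [Decidable p] [Decidable p'],
      ((if p then innerDeriv (e r) else 0) - B)
          * ((if p' then (AddMonoid.End.mulRight (e r')) else 0) - A)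
        - ((if p' then (AddMonoid.End.mulRight (e r')) else 0) - A)
          * ((if p then innerDeriv (e r) else 0) - B)
        = (if p then ∑ j, AddMonoid.End.mulLeft (w j) * sandwich x d w j c' r' else 0)
          + (B * A - A * B) := by
    intro p p' _ _
    by_cases hp : p <;> by_cases hp' : p' <;>
      simp only [hp, hp', if_true, if_false, sub_mul, mul_sub, zero_mul, mul_zero, hBE, hUA,
        hUE] <;> abel
  rw [key, hBA, add_sub_cancel_left]

/-- The column determinant does not change if all products are normally ordered. -/
theorem cdet_capelliMatrix (h : IsCapelliSystem m x d w e) :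
    cdet (capelliMatrix x d w e) = ∑ σ : Equiv.Perm (Fin k), ((Equiv.Perm.sign σ : ℤˣ) : ℤ) •
      (List.ofFn fun a => normalInsert x d w e (σ a) a).prod 1 := by
  have hL : cdet (capelliMatrix x d w e) = antisymSum k
      (fun a c => AddMonoid.End.mulLeft (capelliMatrix x d w e c a))
      permWeight 1 := by
    rw [antisymSum_permWeight, cdet]
    refine Finset.sum_congr rfl fun σ _ => ?_
    have h1 := map_list_prod (Module.toAddMonoidEnd R R)
      (List.ofFn fun a => capelliMatrix x d w e (σ a) a)
    rw [List.map_ofFn] at h1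
    have h2 := congrArg (fun f : AddMonoid.End R => f 1) h1
    have h3 : ∀ p : R, Module.toAddMonoidEnd R R p 1 = p := fun p => mul_one p
    rw [h3] at h2
    rw [h2]
    rfl
  rw [hL, ← antisymSum_permWeight (fun a c => normalInsert x d w e c a)]
  refine antisymSum_congr _ _ 1 (fun a c => ?_) (fun a b c c' q _ => ?_) _ isAntisymm_permWeight
  · rw [← sub_eq_zero]
    change (AddMonoid.End.mulLeft (capelliMatrix x d w e c a) - normalInsert x d w e c a
      : AddMonoid.End R) 1 = 0
    rw [h.mulLeft_sub_normalInsert]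
    have h1 : innerDeriv (e a) 1 = 0 := by rw [innerDeriv_apply, mul_one, one_mul, sub_self]
    have h2 : (∑ i, contraction x d w i c a) 1 = 0 :=
      (AddMonoidHom.finsetSum_apply _ _ _).trans (Finset.sum_eq_zero fun i _ =>
        (contraction_apply x d w i c a 1).trans (by rw [mul_one, one_mul, sub_self, mul_zero]))
    refine (congrArg₂ (· - ·) ?_ h2).trans (sub_zero 0)
    split_ifs
    · exact h1
    · rfl
  · have h1 := h.commutator_normalInsert c a c' b
    rw [add_comm, ← h.commutator_normalInsert c' a c b] at h1
    exact congrArg (fun f : AddMonoid.End R => f q) h1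

end IsCapelliSystem

end NormalOrdering

/-! ### Reordering products of elements that commute up to a sign -/

section Reordering

variable {ι R : Type*} [LinearOrder ι] [Ring R]

/-- The product of `s a b` over all pairs of entries `a`, `b` of the list with `a` before `b` and
`b < a`. -/
def inversionWeight (s : ι → ι → ℤ) : List ι → ℤ
  | [] => 1
  | a :: L => (L.map fun b => if b < a then s a b else 1).prod * inversionWeight s L

theorem inversionWeight_ofFn (s : ι → ι → ℤ) {l : ℕ} (F : Fin l → ι) :
    inversionWeight s (List.ofFn F)
      = ∏ a, ∏ b, if a < b ∧ F b < F a then s (F a) (F b) else 1 := by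
  induction l with
  | zero => simp [inversionWeight]
  | succ l ih =>
    rw [List.ofFn_succ, inversionWeight, ih, Fin.prod_univ_succ, Fin.prod_univ_succ,
      List.map_ofFn, List.prod_ofFn]
    congr 1
    · simp [Fin.succ_pos]
    · refine Finset.prod_congr rfl fun a _ => ?_
      rw [Fin.prod_univ_succ, if_neg (by simp), one_mul]
      simp only [Fin.succ_lt_succ_iff]

/-- Inserting `y a` into a product of the `y b` ordered by `b`. -/
theorem mul_prod_map_of_sorted (s : ι → ι → ℤ) (y : ι → R)
    (hy : ∀ a b, y a * y b = s a b • (y b * y a)) (a : ι) (L : List ι)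
    (hL : L.Pairwise (· ≤ ·)) :
    y a * (L.map y).prod = (L.map fun b => if b < a then s a b else 1).prod •
      ((L.orderedInsert (· ≤ ·) a).map y).prod := by
  induction L with
  | nil => simp
  | cons b L ih =>
    rw [List.pairwise_cons] at hL
    by_cases hab : a ≤ b
    · have h1 : ((b :: L).map fun b => if b < a then s a b else 1).prod = 1 := by
        refine List.prod_eq_one fun t ht => ?_
        obtain ⟨c, hc, rfl⟩ := List.mem_map.mp ht
        refine if_neg (not_lt.mpr ?_)
        rcases List.mem_cons.mp hc with rfl | hc
        · exact hab
        · exact hab.trans (hL.1 c hc)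
      rw [h1, one_smul, List.orderedInsert_cons_of_le _ _ hab]
      simp
    · rw [List.orderedInsert_of_not_le (· ≤ ·) L hab, List.map_cons, List.prod_cons, List.map_cons,
        List.prod_cons, List.map_cons, List.prod_cons, if_pos (not_le.mp hab), ← mul_assoc, hy,
        smul_mul_assoc, mul_assoc, ih hL.2, mul_smul_comm, smul_smul]

theorem prod_map_eq_inversionWeight_smul (s : ι → ι → ℤ) (y : ι → R)
    (hy : ∀ a b, y a * y b = s a b • (y b * y a)) (L : List ι) :
    (L.map y).prod = inversionWeight s L • ((L.insertionSort (· ≤ ·)).map y).prod := by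
  induction L with
  | nil => simp [inversionWeight]
  | cons a L ih =>
    have h1 := mul_prod_map_of_sorted s y hy a _ (List.pairwise_insertionSort (· ≤ ·) L)
    rw [((List.perm_insertionSort (· ≤ ·) L).map _).prod_eq] at h1
    rw [List.map_cons, List.prod_cons, ih, mul_smul_comm, h1, smul_smul, inversionWeight,
      mul_comm (inversionWeight s L), List.insertionSort_cons]

theorem prod_ofFn_perm {k : ℕ} (s : Fin k → Fin k → ℤ) (y : Fin k → R)
    (hy : ∀ a b, y a * y b = s a b • (y b * y a)) (τ : Equiv.Perm (Fin k)) :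
    (List.ofFn fun a => y (τ a)).prod
      = (∏ a, ∏ b, if a < b ∧ τ b < τ a then s (τ a) (τ b) else 1) • (List.ofFn y).prod := by
  have h1 : (List.ofFn τ).insertionSort (· ≤ ·) = List.ofFn id := by
    refine List.Perm.eq_of_pairwise (le := (· ≤ ·)) (fun a b _ _ => le_antisymm)
      (List.pairwise_insertionSort _ _) ?_ ?_
    · rw [List.ofFn_id]
      exact List.pairwise_le_finRange k
    · exact (List.perm_insertionSort _ _).trans (Equiv.Perm.ofFn_comp_perm τ id)
  have h2 := prod_map_eq_inversionWeight_smul s y hy (List.ofFn τ)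
  rw [h1, List.map_ofFn, List.map_ofFn, inversionWeight_ofFn] at h2
  exact h2

end Reordering

section Lists

variable {R : Type*} [Ring R]

theorem prod_ofFn_sum {o : Type*} [Fintype o] {l : ℕ} (A : Fin l → o → R) :
    (List.ofFn fun a => ∑ t, A a t).prod
      = ∑ j : Fin l → o, (List.ofFn fun a => A a (j a)).prod := by
  induction l with
  | zero => simp
  | succ l ih =>
    rw [List.ofFn_succ, List.prod_cons, ih, Finset.sum_mul, ← (Fin.consEquiv fun _ => o).sum_comp,
      Fintype.sum_prod_type]
    refine Finset.sum_congr rfl fun c _ => ?_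
    rw [Finset.mul_sum]
    refine Finset.sum_congr rfl fun f _ => ?_
    rw [List.ofFn_succ, List.prod_cons]
    rfl

/-- Operators `q ↦ p_a q r_a` applied one after another collect the `r_a` in reverse order. -/
theorem prod_ofFn_sandwich {l : ℕ} (A : Fin l → AddMonoid.End R) (c : Fin l → ℤ) (p r : Fin l → R)
    (h : ∀ a q, A a q = c a • (p a * q * r a)) :
    (List.ofFn A).prod 1
      = (∏ a, c a) • ((List.ofFn p).prod * (List.ofFn fun a => r (Fin.revPerm a)).prod) := by
  induction l with
  | zero => simp
  | succ l ih =>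
    have h1 : (List.ofFn fun a => r (Fin.revPerm a)).prod
        = (List.ofFn fun a : Fin l => r (Fin.succ (Fin.revPerm a))).prod * r 0 := by
      rw [List.ofFn_succ', List.concat_eq_append, List.prod_append]
      simp [Fin.rev_castSucc]
    rw [List.ofFn_succ, List.prod_cons]
    change A 0 ((List.ofFn fun a => A a.succ).prod 1) = _
    rw [ih (fun a => A a.succ) (fun a => c a.succ) (fun a => p a.succ) (fun a => r a.succ)
      (fun a => h a.succ), h, Fin.prod_univ_succ, List.ofFn_succ, List.prod_cons, h1,
      mul_smul_comm, smul_mul_assoc, smul_smul]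
    simp only [mul_assoc]

theorem commute_prod_ofFn {l : ℕ} {x : R} {y : Fin l → R} (h : ∀ a, Commute x (y a)) :
    Commute x (List.ofFn y).prod :=
  Commute.list_prod_right _ _ fun t ht => by
    obtain ⟨a, rfl⟩ := List.mem_ofFn.mp ht
    exact h a

theorem prod_ofFn_mul {l : ℕ} (p r : Fin l → R) (h : ∀ a b, Commute (p a) (r b)) :
    (List.ofFn fun a => p a * r a).prod = (List.ofFn p).prod * (List.ofFn r).prod := by
  induction l with
  | zero => simp
  | succ l ih =>
    have h1 : Commute (List.ofFn fun a : Fin l => p a.succ).prod (r 0) :=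
      (commute_prod_ofFn fun a => (h a.succ 0).symm).symm
    rw [List.ofFn_succ, List.prod_cons, ih _ _ fun a b => h a.succ b.succ, List.ofFn_succ,
      List.prod_cons, List.ofFn_succ, List.prod_cons, mul_assoc, ← mul_assoc (r 0), ← h1.eq]
    simp only [mul_assoc]

end Lists

/-! ### Expansion of the normally ordered determinant -/

section Expansion

variable {m n k : ℕ} {R : Type*} [Ring R]

theorem atIndex_some (f : Fin (m + n) → Fin k → R) {j : Fin k → Option (Fin (m + n))} {a : Fin k}
    {i : Fin (m + n)} (h : j a = some i) : atIndex f j a = f i a := by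
  rw [atIndex, h]

theorem atIndex_none (f : Fin (m + n) → Fin k → R) {j : Fin k → Option (Fin (m + n))} {a : Fin k}
    (h : j a = none) : atIndex f j a = 1 := by
  rw [atIndex, h]

theorem commute_atIndex {f g : Fin (m + n) → Fin k → R} (h : ∀ i a i' b, Commute (f i a) (g i' b))
    (j j' : Fin k → Option (Fin (m + n))) (a b : Fin k) :
    Commute (atIndex f j a) (atIndex g j' b) := by
  rcases ha : j a with _ | i
  · rw [atIndex_none f ha]
    exact Commute.one_left _
  rcases hb : j' b with _ | i'
  · rw [atIndex_none g hb]
    exact Commute.one_right _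
  rw [atIndex_some f ha, atIndex_some g hb]
  exact h i a i' b

theorem oddAt_some {j : Fin k → Option (Fin (m + n))} {a : Fin k} {i : Fin (m + n)}
    (h : j a = some i) : OddAt j a ↔ IsOdd m i := by
  rw [OddAt, h]
  simp

theorem not_oddAt_none {j : Fin k → Option (Fin (m + n))} {a : Fin k} (h : j a = none) :
    ¬ OddAt j a := by
  rw [OddAt, h]
  simp

theorem atIndex_mul_atIndex (f : Fin (m + n) → Fin k → R)
    (hf : ∀ i i' a b, f i a * f i' b = paritySign m i i' • (f i' b * f i a))
    (j : Fin k → Option (Fin (m + n))) (a b : Fin k) :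
    atIndex f j a * atIndex f j b
      = (if OddAt j a ∧ OddAt j b then -1 else 1 : ℤ) • (atIndex f j b * atIndex f j a) := by
  rcases ha : j a with _ | i
  · simp [atIndex_none f ha, not_oddAt_none ha]
  rcases hb : j b with _ | i'
  · simp [atIndex_none f hb, not_oddAt_none hb]
  rw [atIndex_some f ha, atIndex_some f hb, hf, paritySign]
  simp only [oddAt_some ha, oddAt_some hb]

/-- The sign `(-1) ^ #`, where `#` counts the pairs of odd positions of `j` not inverted by `σ`. -/
def koszulSign (j : Fin k → Option (Fin (m + n))) (σ : Equiv.Perm (Fin k)) : ℤ :=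
  (-1) ^ (Finset.univ.filter fun p : Fin k × Fin k =>
    p.1 < p.2 ∧ σ p.1 < σ p.2 ∧ OddAt j p.1 ∧ OddAt j p.2).card

theorem koszulSign_eq_prod (j : Fin k → Option (Fin (m + n))) (σ : Equiv.Perm (Fin k)) :
    koszulSign j σ
      = ∏ a, ∏ b, if a < b ∧ σ a < σ b ∧ OddAt j a ∧ OddAt j b then (-1 : ℤ) else 1 := by
  rw [koszulSign, ← Finset.prod_const, Finset.prod_filter, ← Fintype.prod_prod_type']

/-- The permutation fixes the positions where `j` has the value `0`. -/
def FixesNone (j : Fin k → Option (Fin (m + n))) (σ : Equiv.Perm (Fin k)) : Prop :=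
  ∀ a, j a = none → σ a = a

instance (j : Fin k → Option (Fin (m + n))) (σ : Equiv.Perm (Fin k)) :
    Decidable (FixesNone j σ) :=
  inferInstanceAs (Decidable (∀ a, j a = none → σ a = a))

/-- The positions where `j` does not have the value `0`. -/
def supp (j : Fin k → Option (Fin (m + n))) : Finset (Fin k) :=
  Finset.univ.filter fun a => j a ≠ none

/-- The normally ordered product `x_{j₁} ∂_{j₂} ∏ (u - Λ_{j₂(a)})⁻¹ ∏ (∂_u - z_a)`. -/
def normalProd (x d : Fin (m + n) → Fin k → R) (w : Fin (m + n) → R) (e : Fin k → R)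
    (j₁ j₂ : Fin k → Option (Fin (m + n))) : R :=
  (List.ofFn (atIndex x j₁)).prod * (List.ofFn (atIndex d j₂)).prod
    * (List.ofFn (atIndex (fun i _ => w i) j₂)).prod
    * (List.ofFn fun a => if j₂ a = none then e a else 1).prod

variable {x d : Fin (m + n) → Fin k → R} {w : Fin (m + n) → R} {e : Fin k → R}

/-- A summand of `normalInsert`. -/
def insertLetter (x d : Fin (m + n) → Fin k → R) (w : Fin (m + n) → R) (e : Fin k → R)
    (c a : Fin k) : Option (Fin (m + n)) → AddMonoid.End R
  | none => if c = a then AddMonoid.End.mulRight (e a) else 0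
  | some i => -sandwich x d w i c a

theorem normalInsert_eq_sum (c a : Fin k) :
    normalInsert x d w e c a = ∑ o, insertLetter x d w e c a o := by
  rw [Fintype.sum_option, normalInsert, sub_eq_add_neg, ← Finset.sum_neg_distrib]
  rfl

theorem insertLetter_apply (σ : Equiv.Perm (Fin k)) (j : Fin k → Option (Fin (m + n)))
    (a : Fin k) (q : R) :
    insertLetter x d w e (σ a) a (j a) q
      = (if j a = none then if σ a = a then 1 else 0 else -1 : ℤ) •
        (atIndex (fun i _ => w i) j a * atIndex x (j ∘ σ.symm) (σ a) * q
          * (atIndex d j a * if j a = none then e a else 1)) := by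
  rcases ha : j a with _ | i
  · have hσ : (j ∘ σ.symm) (σ a) = none := by simpa using ha
    rw [atIndex_none _ ha, atIndex_none _ ha, atIndex_none _ hσ, insertLetter, one_mul, one_mul,
      one_mul, if_pos rfl, if_pos rfl]
    split_ifs
    · rw [one_smul]
      rfl
    · rw [zero_smul]
      rfl
  · have hσ : (j ∘ σ.symm) (σ a) = some i := by simpa using ha
    rw [atIndex_some _ ha, atIndex_some _ ha, atIndex_some _ hσ, insertLetter, if_neg (by simp),
      if_neg (by simp), mul_one, neg_one_smul, mul_assoc (w i * x i (σ a))]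
    rfl

theorem prod_letterSign (σ : Equiv.Perm (Fin k)) (j : Fin k → Option (Fin (m + n))) :
    (∏ a, if j a = none then if σ a = a then 1 else 0 else -1 : ℤ)
      = if FixesNone j σ then (-1) ^ (supp j).card else 0 := by
  split_ifs with h
  · rw [supp, ← Finset.prod_const, Finset.prod_filter]
    refine Finset.prod_congr rfl fun a _ => ?_
    by_cases ha : j a = none
    · simp [ha, h a ha]
    · simp [ha]
  · simp only [FixesNone, not_forall] at h
    obtain ⟨a, ha, hσ⟩ := h
    exact Finset.prod_eq_zero (Finset.mem_univ a) (by simp [ha, hσ])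

theorem prod_rev_eq_prod (F : Fin k → Fin k → ℤ) :
    (∏ a, ∏ b, F (Fin.revPerm b) (Fin.revPerm a)) = ∏ a, ∏ b, F a b := by
  rw [Finset.prod_comm, ← Equiv.prod_comp Fin.revPerm fun a => ∏ b, F a b]
  exact Finset.prod_congr rfl fun a _ =>
    Equiv.prod_comp Fin.revPerm fun b => F (Fin.revPerm a) b

/-- Sorting the `x` by position and reversing the `∂` contributes a factor `-1` for every pair of
odd positions inverted by `σ` and for every pair of odd positions, respectively. -/
theorem reorder_sign (σ : Equiv.Perm (Fin k)) (j : Fin k → Option (Fin (m + n))) :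
    (∏ a, ∏ b, if a < b ∧ σ b < σ a then
        (if OddAt (j ∘ σ.symm) (σ a) ∧ OddAt (j ∘ σ.symm) (σ b) then -1 else 1) else 1 : ℤ)
      * (∏ a, ∏ b, if a < b ∧ Fin.revPerm b < Fin.revPerm a then
        (if OddAt j (Fin.revPerm a) ∧ OddAt j (Fin.revPerm b) then -1 else 1) else 1 : ℤ)
      = koszulSign j σ := by
  have h1 : ∀ a, OddAt (j ∘ σ.symm) (σ a) ↔ OddAt j a := by
    intro a
    simp [OddAt]
  have h2 := prod_rev_eq_prod fun a b : Fin k =>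
    if a < b then (if OddAt j b ∧ OddAt j a then -1 else 1 : ℤ) else 1
  rw [koszulSign_eq_prod, Finset.prod_congr rfl fun a _ => Finset.prod_congr rfl fun b _ =>
      (show (if a < b ∧ Fin.revPerm b < Fin.revPerm a then
        (if OddAt j (Fin.revPerm a) ∧ OddAt j (Fin.revPerm b) then -1 else 1) else 1 : ℤ)
        = if Fin.revPerm b < Fin.revPerm a then
        (if OddAt j (Fin.revPerm a) ∧ OddAt j (Fin.revPerm b) then -1 else 1) else 1 by
        simp [Fin.rev_lt_rev]), h2, ← Finset.prod_mul_distrib]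
  refine Finset.prod_congr rfl fun a _ => ?_
  rw [← Finset.prod_mul_distrib]
  refine Finset.prod_congr rfl fun b _ => ?_
  simp only [h1]
  by_cases hab : a < b
  · rcases lt_trichotomy (σ a) (σ b) with h | h | h
    · by_cases ha : OddAt j a <;> by_cases hb : OddAt j b <;> simp [hab, h, h.le, ha, hb]
    · exact absurd (σ.injective h) hab.ne
    · by_cases ha : OddAt j a <;> by_cases hb : OddAt j b <;> simp [hab, h, h.le, ha, hb]
  · simp [hab]

namespace IsCapelliSystem

theorem prod_insertLetter (h : IsCapelliSystem m x d w e) (σ : Equiv.Perm (Fin k))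
    (j : Fin k → Option (Fin (m + n))) :
    (List.ofFn fun a => insertLetter x d w e (σ a) a (j a)).prod 1
      = (if FixesNone j σ then (-1) ^ (supp j).card * koszulSign j σ else 0 : ℤ) •
        normalProd x d w e (j ∘ σ.symm) j := by
  have hwx : ∀ a b j', Commute (atIndex (fun i _ => w i) j a) (atIndex x j' b) := fun a b j' =>
    commute_atIndex (f := fun i _ => w i) (fun i _ i' b => h.wx i i' b) j j' a b
  have hwd : ∀ a b, Commute (atIndex (fun i _ => w i) j a) (atIndex d j b) := fun a b =>
    commute_atIndex (f := fun i _ => w i) (fun i _ i' b => h.wd i i' b) j j a b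
  have hde : ∀ a b, Commute (atIndex d j a) (if j b = none then e b else 1) := by
    intro a b
    split_ifs
    · rcases ha : j a with _ | i
      · rw [atIndex_none _ ha]
        exact Commute.one_left _
      · rw [atIndex_some _ ha]
        exact (h.ed b i a).symm
    · exact Commute.one_right _
  have hee : ∀ a b, (if j a = none then e a else 1) * (if j b = none then e b else 1)
      = (1 : ℤ) • ((if j b = none then e b else 1) * (if j a = none then e a else 1)) := by
    intro a b
    rw [one_smul]
    split_ifs
    · exact h.ee a b
    · simp
    · simp
    · simp
  rw [prod_ofFn_sandwich _ _ _ _ fun a q => insertLetter_apply σ j a q, prod_letterSign,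
    prod_ofFn_mul _ _ fun a b => hwx a (σ b) _,
    prod_ofFn_mul (fun a => atIndex d j (Fin.revPerm a)) _ fun a b => hde _ _,
    prod_ofFn_perm _ _ (atIndex_mul_atIndex x h.xx (j ∘ σ.symm)) σ,
    prod_ofFn_perm _ _ (atIndex_mul_atIndex d h.dd j) Fin.revPerm,
    prod_ofFn_perm (fun _ _ => 1) (fun b => if j b = none then e b else 1) hee Fin.revPerm,
    normalProd]
  have hWX : Commute (List.ofFn (atIndex (fun i _ => w i) j)).prod
      ((List.ofFn (atIndex x (j ∘ σ.symm))).prod * (List.ofFn (atIndex d j)).prod) :=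
    (commute_prod_ofFn fun b =>
      (commute_prod_ofFn fun a => (hwx a b _).symm).symm).mul_right
    (commute_prod_ofFn fun b => (commute_prod_ofFn fun a => (hwd a b).symm).symm)
  simp only [ite_self, Finset.prod_const_one, one_smul, smul_mul_assoc, mul_smul_comm, smul_smul]
  rw [mul_assoc (List.ofFn (atIndex (fun i _ => w i) j)).prod,
    ← mul_assoc (List.ofFn (atIndex x _)).prod,
    ← mul_assoc (List.ofFn (atIndex (fun i _ => w i) j)).prod, hWX.eq]
  congr 1
  rw [← mul_assoc, mul_right_comm, mul_assoc, reorder_sign, ite_mul, zero_mul]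

theorem cdet_eq_sum_normalProd (h : IsCapelliSystem m x d w e) :
    cdet (capelliMatrix x d w e) = ∑ σ : Equiv.Perm (Fin k),
      ∑ j : Fin k → Option (Fin (m + n)), (if FixesNone j σ then
        ((Equiv.Perm.sign σ : ℤˣ) : ℤ) * ((-1) ^ (supp j).card * koszulSign j σ) else 0 : ℤ) •
        normalProd x d w e (j ∘ σ.symm) j := by
  rw [h.cdet_capelliMatrix]
  refine Finset.sum_congr rfl fun σ _ => ?_
  have h1 : (List.ofFn fun a => normalInsert x d w e (σ a) a).prod 1
      = ∑ j : Fin k → Option (Fin (m + n)),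
        (List.ofFn fun a => insertLetter x d w e (σ a) a (j a)).prod 1 := by
    simp only [normalInsert_eq_sum]
    rw [prod_ofFn_sum]
    exact AddMonoidHom.finsetSum_apply _ _ _
  rw [h1, Finset.smul_sum]
  refine Finset.sum_congr rfl fun j _ => ?_
  rw [h.prod_insertLetter, smul_smul, mul_ite, mul_zero]

end IsCapelliSystem

end Expansion

/-! ### The sum over the permutations with given `j₁` and `j₂` -/

section FibreSum

variable {m n k : ℕ}

theorem koszulSign_congr {j : Fin k → Option (Fin (m + n))} {σ τ : Equiv.Perm (Fin k)}
    (h : ∀ a, OddAt j a → σ a = τ a) : koszulSign j σ = koszulSign j τ := by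
  unfold koszulSign
  congr 2
  refine Finset.filter_congr fun p _ => ?_
  constructor
  · rintro ⟨h1, h2, h3, h4⟩
    exact ⟨h1, by rwa [← h _ h3, ← h _ h4], h3, h4⟩
  · rintro ⟨h1, h2, h3, h4⟩
    exact ⟨h1, by rwa [h _ h3, h _ h4], h3, h4⟩

/-- An antisymmetric function whose product over all pairs `a < b` is, up to a nonzero factor
that does not depend on `σ`, the sign `koszulSign j σ`. On the pairs that are not both odd it is
invariant under the permutations that move only odd positions. -/
def pairFactor (j : Fin k → Option (Fin (m + n))) (σ : Equiv.Perm (Fin k)) (a b : Fin k) : ℤ :=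
  if OddAt j a ∧ OddAt j b then (if σ a < σ b then -1 else if σ b < σ a then 1 else 0)
  else if OddAt j a then 1 else if OddAt j b then -1
  else if a < b then 1 else if b < a then -1 else 0

theorem pairFactor_antisymm (j : Fin k → Option (Fin (m + n))) (σ : Equiv.Perm (Fin k))
    (a b : Fin k) : pairFactor j σ a b = -pairFactor j σ b a := by
  unfold pairFactor
  by_cases ha : OddAt j a <;> by_cases hb : OddAt j b
  · rcases lt_trichotomy (σ a) (σ b) with h | h | h
    · simp [ha, hb, h, h.not_gt]
    · simp [ha, hb, h]
    · simp [ha, hb, h, h.not_gt]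
  · simp [ha, hb]
  · simp [ha, hb]
  · rcases lt_trichotomy a b with h | h | h
    · simp [ha, hb, h, h.not_gt]
    · simp [hb, h]
    · simp [ha, hb, h, h.not_gt]

theorem prod_pairFactor (j : Fin k → Option (Fin (m + n))) (σ : Equiv.Perm (Fin k)) :
    ∏ a, ∏ b ∈ Finset.Ioi a, pairFactor j σ a b
      = koszulSign j σ * ∏ a, ∏ b ∈ Finset.Ioi a,
        if OddAt j a ∧ OddAt j b then 1 else if OddAt j a then 1 else if OddAt j b then -1
          else 1 := by
  rw [koszulSign_eq_prod, ← Finset.prod_mul_distrib]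
  refine Finset.prod_congr rfl fun a _ => ?_
  have h1 : ∀ h : Fin k → ℤ, ∏ b ∈ Finset.Ioi a, h b = ∏ b, if a < b then h b else 1 := by
    intro h
    rw [← Finset.prod_filter]
    congr 1
    ext b
    simp
  rw [h1, h1, ← Finset.prod_mul_distrib]
  refine Finset.prod_congr rfl fun b _ => ?_
  by_cases hab : a < b
  · unfold pairFactor
    by_cases ha : OddAt j a <;> by_cases hb : OddAt j b
    · rcases lt_trichotomy (σ a) (σ b) with h | h | h
      · simp [ha, hb, h, hab]
      · exact absurd (σ.injective h) hab.ne
      · simp [ha, hb, h, hab, h.not_gt]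
    · simp [ha, hb, hab]
    · simp [ha, hb, hab]
    · simp [ha, hb, hab]
  · simp [hab]

/-- Permuting the odd positions among themselves does not change `sgn σ * koszulSign j σ`. -/
theorem sign_mul_koszulSign_mul (j : Fin k → Option (Fin (m + n))) (σ π : Equiv.Perm (Fin k))
    (hπ : ∀ a, ¬ OddAt j a → π a = a) :
    ((Equiv.Perm.sign (σ * π) : ℤˣ) : ℤ) * koszulSign j (σ * π)
      = ((Equiv.Perm.sign σ : ℤˣ) : ℤ) * koszulSign j σ := by
  have hodd : ∀ a, OddAt j (π a) ↔ OddAt j a := by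
    intro a
    by_cases ha : OddAt j a
    · by_cases hb : OddAt j (π a)
      · exact iff_of_true hb ha
      · exact absurd ha (π.injective (hπ _ hb) ▸ hb)
    · rw [hπ a ha]
  have hpair : ∀ a b, pairFactor j σ (π a) (π b) = pairFactor j (σ * π) a b := by
    intro a b
    unfold pairFactor
    simp only [hodd, Equiv.Perm.mul_apply]
    by_cases ha : OddAt j a <;> by_cases hb : OddAt j b
    · simp only [ha, hb, and_self, if_true]
      rfl
    · simp [ha, hb]
    · simp [ha, hb]
    · simp only [hπ a ha, hπ b hb]
  have h1 := π.prod_Ioi_comp_eq_sign_mul_prod (pairFactor_antisymm j σ)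
  simp only [hpair] at h1
  rw [prod_pairFactor, prod_pairFactor, ← mul_assoc] at h1
  -- The factor of the pairs that are not both odd is the same nonzero integer on both sides.
  have h2 := mul_right_cancel₀ (Finset.prod_ne_zero_iff.mpr fun a _ =>
    Finset.prod_ne_zero_iff.mpr fun b _ => by split_ifs <;> simp) h1
  rw [h2, Equiv.Perm.sign_mul, Units.val_mul, Int.cast_id, ← mul_assoc,
    mul_assoc ((Equiv.Perm.sign σ : ℤˣ) : ℤ), Int.units_coe_mul_self, mul_one]

/-- The permutation satisfies `x_{j₂(a), σ(a)} = x_{j₁(σ(a)), σ(a)}` for all `a`, and is the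
identity where the value is `0`. -/
def Carries (j₁ j₂ : Fin k → Option (Fin (m + n))) (σ : Equiv.Perm (Fin k)) : Prop :=
  FixesNone j₂ σ ∧ ∀ a, j₁ (σ a) = j₂ a

instance (j₁ j₂ : Fin k → Option (Fin (m + n))) (σ : Equiv.Perm (Fin k)) :
    Decidable (Carries j₁ j₂ σ) :=
  inferInstanceAs (Decidable (_ ∧ _))

/-- The condition that the even values of `j` are taken at most once. -/
def EvenOnce (j : Fin k → Option (Fin (m + n))) : Prop :=
  ∀ i, ¬ IsOdd m i → fiberCard j i ≤ 1

theorem mem_J_iff {𝔞 : Finset (Fin k)} {j : Fin k → Option (Fin (m + n))} :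
    j ∈ J m n 𝔞 ↔ 𝔞 = supp j ∧ EvenOnce j := by
  rw [J, Finset.mem_filter, and_iff_right (Finset.mem_univ j)]
  refine and_congr ?_ Iff.rfl
  constructor
  · intro h
    ext a
    simp [supp, h a]
  · rintro rfl a
    simp [supp]

theorem Carries.sim {j₁ j₂ : Fin k → Option (Fin (m + n))} {σ : Equiv.Perm (Fin k)}
    (h : Carries j₁ j₂ σ) : Sim j₁ j₂ := by
  intro i
  refine (Finset.card_equiv σ fun a => ?_).symm
  simp [h.2 a]

theorem Carries.supp_eq {j₁ j₂ : Fin k → Option (Fin (m + n))} {σ : Equiv.Perm (Fin k)}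
    (h : Carries j₁ j₂ σ) : supp j₁ = supp j₂ := by
  have h1 : ∀ a, j₂ a = none → j₁ a = none := by
    intro a ha
    have := h.2 a
    rwa [h.1 a ha, ha] at this
  ext a
  simp only [supp, Finset.mem_filter, Finset.mem_univ, true_and, ne_eq, not_iff_not]
  refine ⟨fun ha => ?_, h1 a⟩
  obtain ⟨b, rfl⟩ := σ.surjective a
  have hb : j₂ b = none := by rw [← h.2 b, ha]
  rwa [h.1 b hb]

theorem Sim.evenOnce_iff {j₁ j₂ : Fin k → Option (Fin (m + n))} (h : Sim j₁ j₂) :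
    EvenOnce j₁ ↔ EvenOnce j₂ := by
  simp only [EvenOnce, h _]

theorem IsConnecting.carries {j₁ j₂ : Fin k → Option (Fin (m + n))} {σ : Equiv.Perm (Fin k)}
    (h : IsConnecting j₁ j₂ σ) : Carries j₁ j₂ σ :=
  ⟨h.1, h.2.1⟩

theorem isConnecting_connecting {𝔞 : Finset (Fin k)} {j₁ j₂ : Fin k → Option (Fin (m + n))}
    (h₁ : j₁ ∈ J m n 𝔞) (h₂ : j₂ ∈ J m n 𝔞) (h : Sim j₁ j₂) :
    IsConnecting j₁ j₂ (connecting j₁ j₂) := by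
  have hex := (existsUnique_isConnecting 𝔞 j₁ j₂ h₁ h₂ h).exists
  rw [connecting, dif_pos hex]
  exact hex.choose_spec

/-- If an even value is repeated, exchanging two of its positions cancels the summands in pairs:
this is why only functions with `|j⁻¹(i)| ≤ 1` for even `i` occur in the expansion. -/
theorem sum_carries_eq_zero {j₁ j₂ : Fin k → Option (Fin (m + n))} (h : ¬ EvenOnce j₂) :
    ∑ σ, (if Carries j₁ j₂ σ then
      ((Equiv.Perm.sign σ : ℤˣ) : ℤ) * koszulSign j₂ σ else 0) = 0 := by
  simp only [EvenOnce, not_forall, not_le] at h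
  obtain ⟨i, hi, hcard⟩ := h
  obtain ⟨a, ha, b, hb, hab⟩ := Finset.one_lt_card.mp hcard
  have ha' : j₂ a = some i := (Finset.mem_filter.mp ha).2
  have hb' : j₂ b = some i := (Finset.mem_filter.mp hb).2
  have hj : ∀ c, j₂ (Equiv.swap a b c) = j₂ c := by
    intro c
    by_cases hca : c = a
    · rw [hca, Equiv.swap_apply_left, ha', hb']
    by_cases hcb : c = b
    · rw [hcb, Equiv.swap_apply_right, ha', hb']
    rw [Equiv.swap_apply_of_ne_of_ne hca hcb]
  have hcar : ∀ σ, Carries j₁ j₂ σ → Carries j₁ j₂ (σ * Equiv.swap a b) := by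
    intro σ hσ
    refine ⟨fun c hc => ?_, fun c => ?_⟩
    · have hca : c ≠ a := by
        rintro rfl
        simp [ha'] at hc
      have hcb : c ≠ b := by
        rintro rfl
        simp [hb'] at hc
      rw [Equiv.Perm.mul_apply, Equiv.swap_apply_of_ne_of_ne hca hcb, hσ.1 c hc]
    · rw [Equiv.Perm.mul_apply, hσ.2, hj]
  have hcar' : ∀ σ, Carries j₁ j₂ (σ * Equiv.swap a b) ↔ Carries j₁ j₂ σ := by
    refine fun σ => ⟨fun hσ => ?_, hcar σ⟩
    simpa [mul_assoc] using hcar _ hσ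
  have hk : ∀ σ, koszulSign j₂ (σ * Equiv.swap a b) = koszulSign j₂ σ := by
    intro σ
    refine koszulSign_congr fun c hc => ?_
    have hca : c ≠ a := by
      rintro rfl
      exact hi ((oddAt_some ha').mp hc)
    have hcb : c ≠ b := by
      rintro rfl
      exact hi ((oddAt_some hb').mp hc)
    rw [Equiv.Perm.mul_apply, Equiv.swap_apply_of_ne_of_ne hca hcb]
  refine Finset.sum_involution (fun σ _ => σ * Equiv.swap a b) ?_ ?_ (by simp)
    (by simp [mul_assoc])
  · intro σ _
    simp only [hcar', hk, Equiv.Perm.sign_mul, Equiv.Perm.sign_swap hab]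
    split_ifs <;> simp
  · intro σ _ _ hσ
    exact hab (Equiv.swap_eq_one_iff.mp (mul_eq_left.mp hσ))

theorem card_fibre_preserving {j : Fin k → Option (Fin (m + n))} (h : EvenOnce j) :
    ((Finset.univ.filter fun π : Equiv.Perm (Fin k) => Carries j j π).card : ℤ)
      = oddFactorials j := by
  -- The positions with value `0` are given distinct values, so that they have to be fixed.
  let f : Fin k → Fin k ⊕ Fin (m + n) := fun a => (j a).elim (Sum.inl a) Sum.inr
  have hfn : ∀ a, j a = none → f a = Sum.inl a := fun a ha => by simp [f, ha]
  have hfs : ∀ a i, j a = some i → f a = Sum.inr i := fun a i ha => by simp [f, ha]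
  have hiff : ∀ π : Equiv.Perm (Fin k), Carries j j π ↔ f ∘ π = f := by
    intro π
    constructor
    · intro hπ
      funext a
      rcases ha : j a with _ | i
      · rw [Function.comp_apply, hπ.1 a ha]
      · rw [Function.comp_apply, hfs a i ha, hfs _ i ((hπ.2 a).trans ha)]
    · intro hπ
      have hπ' : ∀ a, f (π a) = f a := congrFun hπ
      have hnone : ∀ a, j a = none → π a = a := by
        intro a ha
        have h1 := hπ' a
        rw [hfn a ha] at h1
        rcases hb : j (π a) with _ | i
        · rw [hfn _ hb] at h1
          exact Sum.inl_injective h1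
        · rw [hfs _ i hb] at h1
          cases h1
      refine ⟨hnone, fun a => ?_⟩
      rcases ha : j a with _ | i
      · rw [hnone a ha, ha]
      · have h1 := hπ' a
        rw [hfs a i ha] at h1
        rcases hb : j (π a) with _ | i'
        · rw [hfn _ hb] at h1
          cases h1
        · rw [hfs _ i' hb] at h1
          rw [Sum.inr_injective h1]
  have hinl : ∀ a, Fintype.card {b // f b = Sum.inl a} ≤ 1 := by
    intro a
    rw [Fintype.card_le_one_iff]
    have h1 : ∀ b, f b = Sum.inl a → b = a := by
      intro b hb
      rcases hjb : j b with _ | i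
      · rw [hfn b hjb] at hb
        exact Sum.inl_injective hb
      · rw [hfs b i hjb] at hb
        cases hb
    exact fun b c => Subtype.ext ((h1 b b.2).trans (h1 c c.2).symm)
  have hinr : ∀ i, Fintype.card {b // f b = Sum.inr i} = fiberCard j i := by
    intro i
    rw [Fintype.card_subtype, fiberCard]
    congr 1
    refine Finset.filter_congr fun b _ => ?_
    rcases hjb : j b with _ | i'
    · simp [hfn b hjb]
    · simp [hfs b i' hjb]
  rw [Finset.filter_congr fun π _ => hiff π, ← Fintype.card_subtype, DomMulAct.stabilizer_card,
    Fintype.prod_sum_type, Finset.prod_eq_one fun a _ => Nat.factorial_eq_one.mpr (hinl a), one_mul,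
    oddFactorials, Nat.cast_prod, Finset.prod_filter]
  refine Finset.prod_congr rfl fun i _ => ?_
  rw [hinr]
  split_ifs with hi
  · rfl
  · rw [Nat.factorial_eq_one.mpr (h i hi), Nat.cast_one]

/-- All summands agree with the one of `σ_{j₁,j₂}`, and their number is the number of permutations
preserving the fibres of `j₂`. -/
theorem sum_carries_eq {𝔞 : Finset (Fin k)} {j₁ j₂ : Fin k → Option (Fin (m + n))}
    (h₁ : j₁ ∈ J m n 𝔞) (h₂ : j₂ ∈ J m n 𝔞) (h : Sim j₁ j₂) :
    ∑ σ, (if Carries j₁ j₂ σ then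
      ((Equiv.Perm.sign σ : ℤˣ) : ℤ) * koszulSign j₂ σ else 0)
      = pairSign j₁ j₂ * ((Equiv.Perm.sign (connecting j₁ j₂) : ℤˣ) : ℤ) * oddFactorials j₂ := by
  have heven : EvenOnce j₂ := (mem_J_iff.mp h₂).2
  have hc := (isConnecting_connecting h₁ h₂ h).carries
  set τ := connecting j₁ j₂ with hτ
  have hiff : ∀ π, Carries j₁ j₂ (τ * π) ↔ Carries j₂ j₂ π := by
    intro π
    have h1 : (∀ a, j₁ ((τ * π) a) = j₂ a) ↔ ∀ a, j₂ (π a) = j₂ a := by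
      simp only [Equiv.Perm.mul_apply, hc.2]
    rw [Carries, Carries, h1]
    refine and_congr_left fun hπ => forall₂_congr fun a ha => ?_
    rw [Equiv.Perm.mul_apply, hc.1 (π a) ((hπ a).trans ha)]
  have hodd : ∀ π, Carries j₂ j₂ π → ∀ a, ¬ OddAt j₂ a → π a = a := by
    intro π hπ a ha
    rcases hja : j₂ a with _ | i
    · exact hπ.1 a hja
    · rw [oddAt_some hja] at ha
      exact Finset.card_le_one.mp (heven i ha) _ (by simpa using (hπ.2 a).trans hja) _
        (by simpa using hja)
  rw [← Equiv.sum_comp (Equiv.mulLeft τ)]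
  calc _ = ∑ π, if Carries j₂ j₂ π then
        ((Equiv.Perm.sign τ : ℤˣ) : ℤ) * koszulSign j₂ τ else 0 := by
        refine Finset.sum_congr rfl fun π _ => ?_
        simp only [Equiv.coe_mulLeft, hiff]
        split_ifs with hπ
        · exact sign_mul_koszulSign_mul j₂ τ π (hodd π hπ)
        · rfl
    _ = _ := by
        rw [← Finset.sum_filter, Finset.sum_const, nsmul_eq_mul, card_fibre_preserving heven,
          show pairSign j₁ j₂ = koszulSign j₂ τ from rfl]
        ring

end FibreSum

/-! ### Collecting the terms by `𝔞`, `j₁` and `j₂` -/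

section Collect

variable {m n k : ℕ} {R : Type*} [Ring R] {x d : Fin (m + n) → Fin k → R} {w : Fin (m + n) → R}
  {e : Fin k → R}

theorem carries_iff {j₁ j₂ : Fin k → Option (Fin (m + n))} {σ : Equiv.Perm (Fin k)} :
    Carries j₁ j₂ σ ↔ j₁ = j₂ ∘ σ.symm ∧ FixesNone j₂ σ := by
  rw [Carries, and_comm]
  refine and_congr_left fun _ => ⟨fun h => ?_, ?_⟩
  · funext a
    rw [Function.comp_apply, ← h, σ.apply_symm_apply]
  · rintro rfl a
    simp

theorem IsCapelliSystem.cdet_eq_sum_carries (h : IsCapelliSystem m x d w e) :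
    cdet (capelliMatrix x d w e) = ∑ j₁ : Fin k → Option (Fin (m + n)),
      ∑ j₂ : Fin k → Option (Fin (m + n)), ((∑ σ : Equiv.Perm (Fin k), if Carries j₁ j₂ σ then
        ((Equiv.Perm.sign σ : ℤˣ) : ℤ) * koszulSign j₂ σ else 0) * (-1) ^ (supp j₂).card) •
        normalProd x d w e j₁ j₂ := by
  rw [h.cdet_eq_sum_normalProd, Finset.sum_comm]
  conv_rhs => rw [Finset.sum_comm]
  refine Finset.sum_congr rfl fun j₂ _ => ?_
  simp only [Finset.sum_mul, Finset.sum_smul]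
  conv_rhs => rw [Finset.sum_comm]
  refine Finset.sum_congr rfl fun σ _ => ?_
  rw [Finset.sum_eq_single (j₂ ∘ σ.symm)]
  · simp only [carries_iff, true_and]
    split_ifs
    · congr 1
      ring
    · simp
  · intro j₁ _ hj
    rw [if_neg fun hc => hj (carries_iff.mp hc).1, zero_mul, zero_smul]
  · simp

/-- The normally ordered expansion for an abstract system of generators. The supports of `j₁` and
`j₂` agree as soon as a permutation carries one to the other, and `𝔞` is this support. -/
theorem IsCapelliSystem.cdet_eq_sum_J (h : IsCapelliSystem m x d w e) :
    cdet (capelliMatrix x d w e) = ∑ 𝔞 : Finset (Fin k), ∑ j₁ ∈ J m n 𝔞,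
      ∑ j₂ ∈ (J m n 𝔞).filter (fun j₂ => Sim j₁ j₂),
        (coeffSign 𝔞 j₁ j₂ * oddFactorials j₂) • normalProd x d w e j₁ j₂ := by
  have hterm : ∀ (𝔞 : Finset (Fin k)) (j₁ j₂ : Fin k → Option (Fin (m + n))),
      (if 𝔞 = supp j₂ then ((∑ σ : Equiv.Perm (Fin k), if Carries j₁ j₂ σ then
        ((Equiv.Perm.sign σ : ℤˣ) : ℤ) * koszulSign j₂ σ else 0) * (-1) ^ (supp j₂).card) •
        normalProd x d w e j₁ j₂ else 0)
      = if j₁ ∈ J m n 𝔞 then if j₂ ∈ J m n 𝔞 then if Sim j₁ j₂ then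
        (coeffSign 𝔞 j₁ j₂ * oddFactorials j₂) • normalProd x d w e j₁ j₂ else 0 else 0 else 0 := by
    intro 𝔞 j₁ j₂
    by_cases hall : j₁ ∈ J m n 𝔞 ∧ j₂ ∈ J m n 𝔞 ∧ Sim j₁ j₂
    · obtain ⟨h₁, h₂, hs⟩ := hall
      have h𝔞 := (mem_J_iff.mp h₂).1
      rw [if_pos h₁, if_pos h₂, if_pos hs, if_pos h𝔞, sum_carries_eq h₁ h₂ hs, ← h𝔞, coeffSign]
      congr 1
      ring
    · have hr : (if j₁ ∈ J m n 𝔞 then if j₂ ∈ J m n 𝔞 then if Sim j₁ j₂ then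
          (coeffSign 𝔞 j₁ j₂ * oddFactorials j₂) • normalProd x d w e j₁ j₂ else 0 else 0 else 0)
          = 0 := by
        split_ifs with h₁ h₂ hs
        · exact absurd ⟨h₁, h₂, hs⟩ hall
        · rfl
        · rfl
        · rfl
      rw [hr]
      split_ifs with h𝔞
      · by_cases heven : EvenOnce j₂
        · rw [Finset.sum_eq_zero fun σ _ => if_neg fun hσ => hall
            ⟨mem_J_iff.mpr ⟨h𝔞.trans hσ.supp_eq.symm, hσ.sim.evenOnce_iff.mpr heven⟩,
              mem_J_iff.mpr ⟨h𝔞, heven⟩, hσ.sim⟩, zero_mul, zero_smul]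
        · rw [sum_carries_eq_zero heven, zero_mul, zero_smul]
      · rfl
  have hrhs : ∀ 𝔞 : Finset (Fin k), ∑ j₁ ∈ J m n 𝔞, ∑ j₂ ∈ (J m n 𝔞).filter (fun j₂ => Sim j₁ j₂),
      (coeffSign 𝔞 j₁ j₂ * oddFactorials j₂) • normalProd x d w e j₁ j₂
      = ∑ j₁, ∑ j₂, (if 𝔞 = supp j₂ then ((∑ σ : Equiv.Perm (Fin k), if Carries j₁ j₂ σ then
        ((Equiv.Perm.sign σ : ℤˣ) : ℤ) * koszulSign j₂ σ else 0) * (-1) ^ (supp j₂).card) •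
        normalProd x d w e j₁ j₂ else 0) := by
    intro 𝔞
    have hJ : ∀ f : (Fin k → Option (Fin (m + n))) → R,
        ∑ j ∈ J m n 𝔞, f j = ∑ j, if j ∈ J m n 𝔞 then f j else 0 := by
      intro f
      rw [Finset.sum_ite_mem, Finset.univ_inter]
    rw [hJ]
    refine Finset.sum_congr rfl fun j₁ _ => ?_
    simp only [hterm]
    split_ifs
    · rw [Finset.sum_filter, hJ]
    · rw [Finset.sum_const_zero]
  rw [Finset.sum_congr rfl fun 𝔞 _ => hrhs 𝔞, Finset.sum_comm, h.cdet_eq_sum_carries]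
  refine Finset.sum_congr rfl fun j₁ _ => ?_
  rw [Finset.sum_comm]
  refine Finset.sum_congr rfl fun j₂ _ => ?_
  rw [Finset.sum_ite_eq' Finset.univ, if_pos (Finset.mem_univ _)]

end Collect

theorem orderedProd_eq_prod_ofFn {k : ℕ} {R : Type*} [Ring R] (s : Finset (Fin k))
    (f : Fin k → R) : orderedProd s f = (List.ofFn fun a => if a ∈ s then f a else 1).prod := by
  have h1 : s.sort (· ≤ ·) = (List.finRange k).filter (· ∈ s) := by
    refine List.Perm.eq_of_pairwise (le := (· ≤ ·)) (fun a b _ _ => le_antisymm)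
      (Finset.pairwise_sort s (· ≤ ·)) ((List.pairwise_le_finRange k).filter _) ?_
    refine (List.perm_ext_iff_of_nodup (Finset.sort_nodup s (· ≤ ·))
      ((List.nodup_finRange k).filter _)).mpr fun a => ?_
    simp
  have h2 : ∀ L : List (Fin k), ((L.filter (· ∈ s)).map f).prod
      = (L.map fun a => if a ∈ s then f a else 1).prod := by
    intro L
    induction L with
    | nil => rfl
    | cons a L ih => by_cases ha : a ∈ s <;> simp [ha, ih]
  rw [orderedProd, h1, h2, List.ofFn_eq_map]

theorem orderedProd_atIndex {m n k : ℕ} {R : Type*} [Ring R] {𝔞 : Finset (Fin k)}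
    {j : Fin k → Option (Fin (m + n))} (h : 𝔞 = supp j) (f : Fin (m + n) → Fin k → R) :
    orderedProd 𝔞 (atIndex f j) = (List.ofFn (atIndex f j)).prod := by
  rw [orderedProd_eq_prod_ofFn]
  congr 2
  funext a
  subst h
  rcases ha : j a with _ | i
  · simp [supp, ha, atIndex_none]
  · simp [supp, ha]

/-! ### The relations in `𝒟((u⁻¹))[∂_u]` -/

section Relations

variable {m n k : ℕ}

theorem superSign_smul {V : Type*} [AddCommGroup V] [Module ℂ V] (i j : Fin (m + n)) (v : V) :
    superSign m i j • v = paritySign m i j • v := by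
  unfold superSign paritySign
  split_ifs <;> simp

theorem X_mul_X (i j : Fin (m + n)) (a b : Fin k) :
    X m n i a * X m n j b = paritySign m i j • (X m n j b * X m n i a) := by
  have h1 := RingQuot.mkAlgHom_rel ℂ (SuperRel.xx (m := m) (n := n) i j a b)
  rw [superSign_smul, map_sub, map_zero, map_zsmul, map_mul, map_mul, sub_eq_zero] at h1
  have h2 := congrArg (incl m n k) h1
  rwa [map_zsmul, map_mul, map_mul] at h2

theorem D_mul_D (i j : Fin (m + n)) (a b : Fin k) :
    D m n i a * D m n j b = paritySign m i j • (D m n j b * D m n i a) := by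
  have h1 := RingQuot.mkAlgHom_rel ℂ (SuperRel.dd (m := m) (n := n) i j a b)
  rw [superSign_smul, map_sub, map_zero, map_zsmul, map_mul, map_mul, sub_eq_zero] at h1
  have h2 := congrArg (incl m n k) h1
  rwa [map_zsmul, map_mul, map_mul] at h2

theorem D_mul_X (i j : Fin (m + n)) (a b : Fin k) :
    D m n i a * X m n j b
      = paritySign m i j • (X m n j b * D m n i a) + if i = j ∧ a = b then 1 else 0 := by
  have h1 := RingQuot.mkAlgHom_rel ℂ (SuperRel.dx (m := m) (n := n) i j a b)
  rw [superSign_smul, map_sub, map_zsmul, map_mul, map_mul, sub_eq_iff_eq_add',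
    apply_ite (RingQuot.mkAlgHom ℂ (SuperRel m n k)), map_one, map_zero] at h1
  have h2 := congrArg (incl m n k) h1
  rwa [map_add, map_zsmul, map_mul, map_mul, apply_ite (incl m n k), map_one, map_zero] at h2

section Series

variable {A : Type*} [Ring A]

theorem commute_uVar_C (a : A) : Commute (uVar A) (HahnSeries.C a) := by
  rw [Commute, SemiconjBy, uVar, HahnSeries.C_apply, HahnSeries.single_mul_single,
    HahnSeries.single_mul_single, one_mul, mul_one, add_comm]

theorem dduHom_C (a : A) : dduHom A (HahnSeries.C a) = 0 := by
  ext r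
  rw [dduHom_coeff, HahnSeries.C_apply, HahnSeries.coeff_zero]
  by_cases hr : r - 1 = 0
  · rw [hr, neg_zero, zero_smul]
  · rw [HahnSeries.coeff_single_of_ne hr, smul_zero]

theorem dduHom_uVar : dduHom A (uVar A) = 1 := by
  ext r
  rw [dduHom_coeff, uVar, HahnSeries.coeff_one]
  by_cases hr : r = 0
  · subst hr
    simp
  · rw [HahnSeries.coeff_single_of_ne (by omega), smul_zero, if_neg hr]

variable [Algebra ℂ A]

theorem commute_C_algebraMap (L : ℂ) (a : A) :
    Commute (HahnSeries.C (algebraMap ℂ A L) : LaurentInv A) (HahnSeries.C a) :=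
  Commute.map (Algebra.commutes L a) (HahnSeries.C : A →+* LaurentInv A)

theorem commute_uSub_inv_C (L : ℂ) (a : A) :
    Commute (((uSub A L)⁻¹ : (LaurentInv A)ˣ) : LaurentInv A) (HahnSeries.C a) :=
  Commute.units_inv_left ((commute_uVar_C a).sub_left (commute_C_algebraMap L a))

theorem commute_uSub_inv_uSub_inv (L L' : ℂ) :
    Commute (((uSub A L)⁻¹ : (LaurentInv A)ˣ) : LaurentInv A)
      ((uSub A L')⁻¹ : (LaurentInv A)ˣ) := by
  refine Commute.units_inv_left (Commute.units_inv_right ?_)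
  exact ((Commute.refl _).sub_right (commute_uVar_C _)).sub_left
    ((commute_uVar_C _).symm.sub_right (commute_C_algebraMap _ _))

theorem dduHom_uSub_inv (L : ℂ) :
    dduHom A ((uSub A L)⁻¹ : (LaurentInv A)ˣ)
      = -(((uSub A L)⁻¹ : (LaurentInv A)ˣ) * ((uSub A L)⁻¹ : (LaurentInv A)ˣ)) := by
  have h1 : dduHom A (uSub A L : LaurentInv A) = 1 := by
    change dduHom A (uVar A - HahnSeries.C (algebraMap ℂ A L)) = 1
    rw [map_sub, dduHom_uVar, dduHom_C, sub_zero]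
  have h2 := dduHom_mul A ((uSub A L)⁻¹ : (LaurentInv A)ˣ) (uSub A L : LaurentInv A)
  rw [Units.inv_mul, h1, mul_one, show (1 : LaurentInv A) = HahnSeries.C 1 from rfl,
    dduHom_C] at h2
  have h3 := congrArg (· * (((uSub A L)⁻¹ : (LaurentInv A)ˣ) : LaurentInv A)) h2
  simp only [zero_mul, add_mul, mul_assoc, Units.mul_inv, mul_one] at h3
  exact eq_neg_of_add_eq_zero_left h3.symm

end Series

theorem commute_resolvent_incl (L : ℂ) (y : SuperWeyl m n k) :
    Commute (resolvent m n k L) (incl m n k y) :=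
  (commute_uSub_inv_C L y).map (DiffOp.const (ddu (SuperWeyl m n k)))

theorem commute_del_incl (y : SuperWeyl m n k) :
    Commute (DiffOp.del (ddu (SuperWeyl m n k))) (incl m n k y) := by
  change DiffOp.del _ * DiffOp.const _ (HahnSeries.C y)
    = DiffOp.const _ (HahnSeries.C y) * DiffOp.del _
  rw [DiffOp.del_mul_const, show (ddu (SuperWeyl m n k)).toHom (HahnSeries.C y) = 0 from dduHom_C y,
    map_zero, add_zero]

theorem commute_incl_algebraMap (c : ℂ) (y : SuperWeyl m n k) :
    Commute (incl m n k (algebraMap ℂ (SuperWeyl m n k) c)) (incl m n k y) :=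
  Commute.map (Algebra.commutes c y) (incl m n k)

theorem commute_delSub_incl (c : ℂ) (y : SuperWeyl m n k) :
    Commute (delSub m n k c) (incl m n k y) :=
  (commute_del_incl y).sub_left (commute_incl_algebraMap c y)

theorem delSub_mul_resolvent (c L : ℂ) :
    delSub m n k c * resolvent m n k L
      = resolvent m n k L * delSub m n k c - resolvent m n k L * resolvent m n k L := by
  have h1 : DiffOp.del (ddu (SuperWeyl m n k)) * resolvent m n k L
      = resolvent m n k L * DiffOp.del (ddu (SuperWeyl m n k))
        - resolvent m n k L * resolvent m n k L := by
    rw [resolvent, DiffOp.del_mul_const, show (ddu (SuperWeyl m n k)).toHom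
      ((uSub (SuperWeyl m n k) L)⁻¹ : (LaurentInv (SuperWeyl m n k))ˣ) = _ from dduHom_uSub_inv L,
      map_neg, map_mul, sub_eq_add_neg]
  rw [delSub, sub_mul, mul_sub, h1, (commute_resolvent_incl L _).eq]
  abel

theorem isCapelliSystem (Λ : Fin (m + n) → ℂ) (z : Fin k → ℂ) :
    IsCapelliSystem m (X m n) (D m n) (fun i => resolvent m n k (Λ i))
      (fun a => delSub m n k (z a)) where
  xx := X_mul_X
  dd := D_mul_D
  dx := D_mul_X
  ww _ _ := (commute_uSub_inv_uSub_inv _ _).map (DiffOp.const (ddu (SuperWeyl m n k)))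
  wx _ _ _ := commute_resolvent_incl _ _
  wd _ _ _ := commute_resolvent_incl _ _
  ee _ _ := ((Commute.refl _).sub_left (commute_del_incl _).symm).sub_right
    (commute_delSub_incl _ _)
  ex _ _ _ := commute_delSub_incl _ _
  ed _ _ _ := commute_delSub_incl _ _
  ew _ _ := delSub_mul_resolvent _ _

end Relations

end CapelliSuper

end

theorem proposition5p3 (m n k : ℕ) (Λ : Fin (m + n) → ℂ) (z : Fin k → ℂ) :
    CapelliSuper.cdet (CapelliSuper.G m n Λ z) =
      ∑ 𝔞 : Finset (Fin k), ∑ j₁ ∈ CapelliSuper.J m n 𝔞,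
        ∑ j₂ ∈ (CapelliSuper.J m n 𝔞).filter (fun j₂ => CapelliSuper.Sim j₁ j₂),
          (CapelliSuper.coeffSign 𝔞 j₁ j₂ * CapelliSuper.oddFactorials j₂) •
            (CapelliSuper.xProd 𝔞 j₁ * CapelliSuper.dProd 𝔞 j₂ *
              CapelliSuper.resolventProd Λ 𝔞 j₂ * CapelliSuper.delProd m n z 𝔞) := by
  refine (CapelliSuper.isCapelliSystem Λ z).cdet_eq_sum_J.trans ?_
  refine Finset.sum_congr rfl fun 𝔞 _ => Finset.sum_congr rfl fun j₁ h₁ =>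
    Finset.sum_congr rfl fun j₂ h₂ => ?_
  have h𝔞₁ := (CapelliSuper.mem_J_iff.mp h₁).1
  have h𝔞₂ := (CapelliSuper.mem_J_iff.mp (Finset.mem_filter.mp h₂).1).1
  rw [CapelliSuper.normalProd, CapelliSuper.xProd, CapelliSuper.dProd, CapelliSuper.resolventProd,
    CapelliSuper.delProd, CapelliSuper.orderedProd_atIndex h𝔞₁,
    CapelliSuper.orderedProd_atIndex h𝔞₂, CapelliSuper.orderedProd_atIndex h𝔞₂,
    CapelliSuper.orderedProd_eq_prod_ofFn]
  have h3 : ∀ a, a ∈ 𝔞ᶜ ↔ j₂ a = none := by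
    intro a
    rw [h𝔞₂]
    simp [CapelliSuper.supp]
  simp only [h3]
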